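/- Let $p$ be an odd prime, let $m=2^e\mu$ with $e\ge 0$ and $\mu$ odd, and let $K=\mathbb{F}_{p^m}$. For $0<k\le\lfloor m/2\rfloor$ with $m/\gcd(m,k)$ odd, for $0\le r\le\lfloor m/2\rfloor$ with $\sigma(x)=x^{p^r}$, and for a nonsquare $\alpha=\alpha_{k,\sigma}\in K$ (any choice, fixed for each pair $(k,\sigma)$), put $x\circ_k y=x^{p^k}y+y^{p^k}x$ and $$(a,b)*(c,d)=\bigl(a\circ_k c+\alpha\,(b\circ_k d)^{\sigma},\ ad+bc\bigr)\qquad\text{on } K\times K\cong\mathbb{F}_{p^{2m}},$$ and let $\mathbb{S}_{k,\sigma}=(K\times K,+,\star)$ be given by $(u*(1,0))\star(v*(1,0))=u*v$. Two presemifields $(V,+,*)$ and $(V,+,\star)$ are isotopic if there are $\mathbb{F}_p$-linear bijections $M,N,L$ of $V$ with $M(x)\star N(y)=L(x*y)$ for all $x,y$. A function $f:V\to V$ is planar if $x\mapsto f(x+a)-f(x)$ is a bijection for every $a\ne0$. The planar functions defined by $\mathbb{S}_{k,\sigma}$ are the maps $x\mapsto x\diamond x$, where $\diamond$ runs over the multiplications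 of the commutative presemifields on $K\times K$ that are isotopic to $\mathbb{S}_{k,\sigma}$; two of them, $f$ and $g$, are equivalent if $g=l_1\circ f\circ l_2$ with $\mathbb{F}_p$-linear bijections $l_1,l_2$. Then every $\mathbb{S}_{k,\sigma}$ is a commutative semifield, the functions that these semifields define are indeed planar, and the family of all $\mathbb{S}_{k,\sigma}$ defines 1. $\lfloor\frac{\mu}{2}\rfloor\cdot\lceil\frac{m}{2}\rceil$ pairwise non-isotopic semifields; 2. $\lfloor\frac{\mu}{2}\rfloor\cdot(\lceil\frac{m}{2}\rceil+1)$ pairwise inequivalent planar functions. More precisely, the semifields of the family form exactly $\lfloor\frac{\mu}{2}\rfloor\cdot(\lfloor\frac{m}{2}\rfloor+1)$ isotopism classes, and the planar functions defined by them form exactly $\lfloor\frac{\mu}{2}\rfloor\cdot(\lfloor\frac{m}{2}\rfloor+2)$ equivalence classes; for odd $m$ these are the numbers in 1. and 2. -/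

import Mathlib

/-! Finite semifields, isotopism, planar functions, and a two-parameter family of
commutative semifields on `K × K`, where `K` is the field with `p ^ m` elements. -/

namespace SemifieldFamily

section General

variable {V : Type*} [AddCommGroup V]

/-- `(V, +, mul)` is a presemifield: both distributive laws hold, `0` is absorbing, and the nonzero
elements form a quasigroup. -/
structure IsPresemifield (mul : V → V → V) : Prop where
  add_mul : ∀ a b c, mul (a + b) c = mul a c + mul b c
  mul_add : ∀ a b c, mul a (b + c) = mul a b + mul a c
  zero_mul : ∀ a, mul 0 a = 0
  mul_zero : ∀ a, mul a 0 = 0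
  mul_ne_zero : ∀ a b, a ≠ 0 → b ≠ 0 → mul a b ≠ 0
  left_div : ∀ a b, a ≠ 0 → b ≠ 0 → ∃! x, x ≠ 0 ∧ mul a x = b
  right_div : ∀ a b, a ≠ 0 → b ≠ 0 → ∃! x, x ≠ 0 ∧ mul x a = b

/-- A semifield is a presemifield with a two-sided multiplicative identity. -/
structure IsSemifield (mul : V → V → V) : Prop extends IsPresemifield mul where
  exists_one : ∃ e, ∀ x, mul e x = x ∧ mul x e = x

/-- `mul` is commutative. -/
def IsCommMul (mul : V → V → V) : Prop := ∀ x y, mul x y = mul y x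

/-- `f` is planar (perfect nonlinear): every difference map in a nonzero direction is bijective. -/
def IsPlanar (f : V → V) : Prop :=
  ∀ a : V, a ≠ 0 → Function.Bijective (fun x => f (x + a) - f x)

/-- Isotopism: there are `𝔽_p`-linear bijections `M, N, L` with `M x ⋆ N y = L (x * y)`, where `*` is
`mul₁` and `⋆` is `mul₂`. -/
def Isotopic (p : ℕ) [Module (ZMod p) V] (mul₁ mul₂ : V → V → V) : Prop :=
  ∃ M N L : V ≃ₗ[ZMod p] V, ∀ x y, mul₂ (M x) (N y) = L (mul₁ x y)

/-- Equivalence (linear equivalence) of planar functions: `g = l₁ ∘ f ∘ l₂` with `𝔽_p`-linear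
bijections `l₁, l₂`. -/
def LinEquivalent (p : ℕ) [Module (ZMod p) V] (f g : V → V) : Prop :=
  ∃ l₁ l₂ : V ≃ₗ[ZMod p] V, ∀ x, g x = l₁ (f (l₂ x))

/-- The planar functions defined by a semifield `(V, +, mul)`: the maps `x ↦ x ∘ x`, for the
commutative presemifields `(V, +, ∘)` that are isotopic to it. -/
def planarFunctionsOf (p : ℕ) [Module (ZMod p) V] (mul : V → V → V) : Set (V → V) :=
  {f | ∃ op : V → V → V, IsPresemifield op ∧ IsCommMul op ∧ Isotopic p op mul ∧
    f = fun x => op x x}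

end General

/-- The set `s` contains `n` elements that are pairwise not related by `R`. -/
def HasPairwiseInequivalent {X : Type*} (R : X → X → Prop) (s : Set X) (n : ℕ) : Prop :=
  ∃ T : Finset X, (T : Set X) ⊆ s ∧ T.card = n ∧ ∀ x ∈ T, ∀ y ∈ T, x ≠ y → ¬ R x y

/-- The set `s` splits into exactly `n` classes under `R`: it has a system of representatives,
pairwise not related by `R`, with `n` elements. -/
def HasExactlyClasses {X : Type*} (R : X → X → Prop) (s : Set X) (n : ℕ) : Prop :=
  ∃ T : Finset X, (T : Set X) ⊆ s ∧ T.card = n ∧ (∀ x ∈ T, ∀ y ∈ T, x ≠ y → ¬ R x y) ∧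
    ∀ x ∈ s, ∃ y ∈ T, R x y

noncomputable section Family

variable {K : Type*} [Field K]

/-- `x ∘_k y = x ^ (p ^ k) * y + y ^ (p ^ k) * x`. -/
def circ (p k : ℕ) (x y : K) : K := x ^ p ^ k * y + y ^ p ^ k * x

/-- The presemifield multiplication
`(a, b) * (c, d) = (a ∘_k c + α (b ∘_k d) ^ σ, a d + b c)`, where `σ x = x ^ (p ^ r)`. -/
def preMul (p k r : ℕ) (α : K) (u v : K × K) : K × K :=
  (circ p k u.1 v.1 + α * (circ p k u.2 v.2) ^ p ^ r, u.1 * v.2 + u.2 * v.1)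

/-- The map `u ↦ u * (1, 0)`, that is `(a, b) ↦ (a + a ^ (p ^ k), b)`; it is a bijection for the
parameters considered below. -/
def unitMap (p k r : ℕ) (α : K) (u : K × K) : K × K := preMul p k r α u (1, 0)

/-- The semifield multiplication `⋆`, given by `(u * (1, 0)) ⋆ (v * (1, 0)) = u * v`. -/
def semiMul (p k r : ℕ) (α : K) (u v : K × K) : K × K :=
  preMul p k r α (Function.invFun (unitMap p k r α) u) (Function.invFun (unitMap p k r α) v)

/-- The parameters of the family: `0 < k ≤ ⌊m/2⌋` with `m / gcd(m, k)` odd, and `0 ≤ r ≤ ⌊m/2⌋`. -/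
def Admissible (m k r : ℕ) : Prop :=
  0 < k ∧ k ≤ m / 2 ∧ Odd (m / Nat.gcd m k) ∧ r ≤ m / 2

/-- The family of all semifields `𝕊_{k,σ}` (as multiplications on `K × K`); `α k r` is the nonsquare
used for the parameters `k` and `σ x = x ^ (p ^ r)`. -/
def semifields (p m : ℕ) (α : ℕ → ℕ → K) : Set (K × K → K × K → K × K) :=
  {mul | ∃ k r, Admissible m k r ∧ mul = semiMul p k r (α k r)}

/-- The planar functions defined by the semifields of the family. -/
def planarFunctions (p m : ℕ) [Algebra (ZMod p) K] (α : ℕ → ℕ → K) : Set (K × K → K × K) :=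
  {f | ∃ mul ∈ semifields p m α, f ∈ planarFunctionsOf p mul}

end Family

end SemifieldFamily

/-! Write `q = p ^ k` and `l = m / gcd m k`, which is odd. The `l`-th iterate of `x ↦ x ^ q` is the
identity of `K`, so `z ^ q = -z` only for `z = 0`, and the multiplication `*` has no zero divisors
because `α` is not a square (`preMul_ne_zero`). Over a field of odd characteristic the planarity of
`x ↦ x ∘ x` is a formal consequence of the presemifield laws.

For the classification, `𝔽_p`-bilinear maps `V × V → K` on `V = K × K` are expanded in the products
of the coordinates `x ^ (p ^ i)`, `y ^ (p ^ i)`, which are linearly independent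
(`exists_coeff`, `bilinear_coeff_unique`). Let `M u * N v = L (u *' v)` be an isotopism between two
members of the family. The second component of `M u * N v` is a sum of two products of linear forms,
so its coefficient matrix has rank at most two; on the other side the matrix `formCoeff` of
`L₂ (u *' v)` is very sparse, and its `3 × 3` minors show that `L₂` is a monomial in the second
component of its argument (`coeff_of_rank`, `unique_of_rank`; for `r = r' = 0` there is one further
shape of rank two, which is excluded by `first_coeff_eq_zero` as `α` is not a square). Hence `M` and
`N` involve a single Frobenius power, and comparing the exponents in the first component determines
`k` and `r` (`parameters_of_single`, `isotopism_rigid`, `parameters_eq_of_isotopic`).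

A commutative presemifield isotopic to `*` is given, up to a strong isotopism, by `T u * v` with a
self-adjoint map `T`, that is, `T u * v = u * T v` (`exists_selfAdjoint_of_mem`). The self-adjoint
maps form a finite field (the middle nucleus), and `T` matters only modulo squares, so a semifield
defines at most two classes of planar functions (`selfAdjoint_sq_or`, `linEquivalent_mul_sq`). For
`r ≠ 0` all self-adjoint maps are scalars from the field fixed by `x ↦ x ^ q`, and all of them give
the class of `u ↦ u * u` (`selfAdjoint_scalar`, `linEquivalent_scalar`). For `r = 0` the field is a
quadratic extension of that fixed field, and contains a `T` whose determinant over `K` is not a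
square; rigidity shows that it gives a second class (`not_linEquivalent`).

The first parameters are the multiples of `2 ^ e` up to `m / 2`, whose number is `μ / 2`, and `r`
takes `m / 2 + 1` values, of which exactly one gives two classes of planar functions. -/

namespace SemifieldFamily

/-! ### Frobenius powers as coordinates on `K × K` -/

section Coordinates

variable (p : ℕ) {m : ℕ} {K : Type*} [Field K] [Fact p.Prime] [CharP K p]

/-- The automorphism `x ↦ x ^ (p ^ i)` of the field with `p ^ m` elements, for an exponent
`i` modulo `m`. -/
def frob (i : ZMod m) : K →+* K := iterateFrobenius K p i.val

variable {p}

theorem frob_natCast [Fintype K] (hK : Fintype.card K = p ^ m) (n : ℕ) (x : K) :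
    frob p (n : ZMod m) x = x ^ p ^ n := by
  have h : x ^ p ^ n = (x ^ (p ^ m) ^ (n / m)) ^ p ^ (n % m) := by
    rw [← pow_mul, ← pow_mul, ← pow_add, Nat.div_add_mod]
  rw [frob, iterateFrobenius_def, ZMod.val_natCast, h, ← hK, FiniteField.pow_card_pow]

theorem frob_zero [Fintype K] (hK : Fintype.card K = p ^ m) (x : K) :
    frob p (0 : ZMod m) x = x := by
  simpa using frob_natCast hK 0 x

theorem frob_add [NeZero m] [Fintype K] (hK : Fintype.card K = p ^ m) (i j : ZMod m) (x : K) :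
    frob p (i + j) x = frob p i (frob p j x) := by
  obtain ⟨a, rfl⟩ := ZMod.natCast_zmod_surjective i
  obtain ⟨b, rfl⟩ := ZMod.natCast_zmod_surjective j
  rw [← Nat.cast_add, frob_natCast hK, frob_natCast hK, frob_natCast hK, ← pow_mul, ← pow_add,
    add_comm]

theorem frob_bijective [NeZero m] [Fintype K] (hK : Fintype.card K = p ^ m) (i : ZMod m) :
    Function.Bijective (frob p i : K → K) := by
  refine Function.bijective_iff_has_inverse.2 ⟨frob p (-i), fun x => ?_, fun x => ?_⟩
  · rw [← frob_add hK, neg_add_cancel, frob_zero hK]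
  · rw [← frob_add hK, add_neg_cancel, frob_zero hK]

theorem frob_injective [NeZero m] [Fintype K] (hK : Fintype.card K = p ^ m) :
    Function.Injective (fun i : ZMod m => ((frob p i : K →+* K) : K →* K)) := by
  intro i j hij
  obtain ⟨g, hg⟩ := IsCyclic.exists_generator (α := Kˣ)
  have ho : orderOf g = p ^ m - 1 := by
    rw [orderOf_eq_card_of_forall_mem_zpowers hg, Nat.card_units,
      Nat.card_eq_fintype_card, hK]
  have hlt : ∀ i : ZMod m, p ^ i.val < p ^ m := fun i =>
    Nat.pow_lt_pow_right (Fact.out : p.Prime).one_lt (ZMod.val_lt i)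
  have h1 : (g : K) ^ p ^ i.val = (g : K) ^ p ^ j.val := by
    simpa [frob, iterateFrobenius_def] using DFunLike.congr_fun hij (g : K)
  rw [← Units.val_pow_eq_pow_val, ← Units.val_pow_eq_pow_val, Units.val_inj] at h1
  have h2 : p ^ i.val = p ^ j.val := by
    have h3 := pow_eq_pow_iff_modEq.1 h1
    rw [ho] at h3
    have hpos : ∀ i : ZMod m, 0 < p ^ i.val := fun i => pow_pos (Fact.out : p.Prime).pos _
    -- both exponents lie between `1` and `p ^ m - 1`
    have h4 : p ^ i.val - 1 ≡ p ^ j.val - 1 [MOD p ^ m - 1] := by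
      refine Nat.ModEq.add_right_cancel' 1 ?_
      rwa [Nat.sub_add_cancel (hpos i), Nat.sub_add_cancel (hpos j)]
    have := hlt i; have := hlt j; have := hpos i; have := hpos j
    have h5 := Nat.ModEq.eq_of_lt_of_lt h4 (by omega) (by omega)
    omega
  exact ZMod.val_injective m (Nat.pow_right_injective (Fact.out : p.Prime).two_le h2)

theorem linearIndependent_frob [NeZero m] [Fintype K] (hK : Fintype.card K = p ^ m) :
    LinearIndependent K (fun i : ZMod m => (frob p i : K → K)) :=
  (linearIndependent_monoidHom K K).comp _ (frob_injective hK)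

theorem eq_zero_of_sum_frob [NeZero m] [Fintype K] (hK : Fintype.card K = p ^ m) {c : ZMod m → K}
    (h : ∀ x : K, ∑ i, c i * frob p i x = 0) (i : ZMod m) : c i = 0 := by
  have hli := linearIndependent_frob hK
  rw [Fintype.linearIndependent_iff] at hli
  refine hli c (funext fun x => ?_) i
  simpa only [Finset.sum_apply, Pi.smul_apply, smul_eq_mul, Pi.zero_apply] using h x

/-- Index set of the coordinates of `K × K`: `inl i` stands for `(x, y) ↦ x ^ (p ^ i)` and `inr i`
for `(x, y) ↦ y ^ (p ^ i)`. -/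
abbrev Idx (m : ℕ) := ZMod m ⊕ ZMod m

variable (p)

/-- The coordinate function on `K × K` with a given index. -/
def coord (s : Idx m) (u : K × K) : K :=
  Sum.elim (fun i => frob p i u.1) (fun i => frob p i u.2) s

variable {p}

@[simp] theorem coord_inl (i : ZMod m) (u : K × K) : coord p (.inl i) u = frob p i u.1 := rfl

@[simp] theorem coord_inr (i : ZMod m) (u : K × K) : coord p (.inr i) u = frob p i u.2 := rfl

theorem coord_add (s : Idx m) (u v : K × K) : coord p s (u + v) = coord p s u + coord p s v := by
  rcases s with i | i <;> simp

theorem eq_zero_of_sum_coord [NeZero m] [Fintype K] (hK : Fintype.card K = p ^ m)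
    {c : Idx m → K} (h : ∀ u : K × K, ∑ s, c s * coord p s u = 0) (s : Idx m) : c s = 0 := by
  simp only [Fintype.sum_sum_type, coord_inl, coord_inr] at h
  rcases s with i | i
  · exact eq_zero_of_sum_frob hK (c := fun i => c (.inl i)) (fun x => by simpa using h (x, 0)) i
  · exact eq_zero_of_sum_frob hK (c := fun i => c (.inr i)) (fun x => by simpa using h (0, x)) i

/-- Every `𝔽_p`-linear function on `K × K` is a `K`-linear combination of the coordinates. -/
theorem exists_coeff [NeZero m] [Fintype K] [Algebra (ZMod p) K] (hK : Fintype.card K = p ^ m)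
    (ψ : K × K →ₗ[ZMod p] K) : ∃ c : Idx m → K, ∀ u, ψ u = ∑ s, c s * coord p s u := by
  let e : Idx m → (K × K →ₗ[ZMod p] K) := fun s =>
    AddMonoidHom.toZModLinearMap p
      ⟨⟨coord p s, by rcases s with i | i <;> simp⟩, coord_add s⟩
  have he : LinearIndependent K e := by
    rw [Fintype.linearIndependent_iff]
    intro c hc
    refine eq_zero_of_sum_coord hK (fun u => ?_)
    have := LinearMap.congr_fun hc u
    simpa [e] using this
  have hm : Module.finrank (ZMod p) K = m := by
    have h := Module.card_eq_pow_finrank (K := ZMod p) (V := K)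
    rw [hK, ZMod.card] at h
    exact (Nat.pow_right_injective (Fact.out : p.Prime).two_le h).symm
  have hcard : Fintype.card (Idx m) = Module.finrank K (K × K →ₗ[ZMod p] K) := by
    rw [Module.finrank_linearMap_self, Module.finrank_prod, hm, Fintype.card_sum, ZMod.card]
  have hspan := he.span_eq_top_of_card_eq_finrank' hcard
  obtain ⟨c, hc⟩ := (Submodule.mem_span_range_iff_exists_fun K (v := e) (x := ψ)).1
    (hspan ▸ Submodule.mem_top)
  refine ⟨c, fun u => ?_⟩
  rw [← hc]
  simp [e]

/-- The products of two coordinates are linearly independent. -/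
theorem bilinear_coeff_unique [NeZero m] [Fintype K] (hK : Fintype.card K = p ^ m)
    {c d : Idx m → Idx m → K}
    (h : ∀ u v : K × K, ∑ s, ∑ t, c s t * (coord p s u * coord p t v) =
      ∑ s, ∑ t, d s t * (coord p s u * coord p t v)) : c = d := by
  funext s t
  rw [← sub_eq_zero]
  refine eq_zero_of_sum_coord hK (c := fun t => c s t - d s t) (fun v => ?_) t
  refine eq_zero_of_sum_coord hK (c := fun s => ∑ t, (c s t - d s t) * coord p t v)
    (fun u => ?_) s
  · simp only [Finset.sum_mul]
    rw [← sub_eq_zero_of_eq (h u v), ← Finset.sum_sub_distrib]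
    refine Finset.sum_congr rfl fun s _ => ?_
    rw [← Finset.sum_sub_distrib]
    exact Finset.sum_congr rfl fun t _ => by ring

/-- Translation of indices by `j`. -/
def shift (j : ZMod m) : Idx m → Idx m := Sum.map (· + j) (· + j)

@[simp] theorem shift_inl (j i : ZMod m) : shift j (.inl i) = .inl (i + j) := rfl

@[simp] theorem shift_inr (j i : ZMod m) : shift j (.inr i) = .inr (i + j) := rfl

variable (p)

/-- If `ψ` has the coefficients `c`, then `ψ ^ (p ^ j)` has the coefficients `twist p j c`. -/
def twist (j : ZMod m) (c : Idx m → K) (s : Idx m) : K := frob p j (c (shift (-j) s))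

variable {p}

@[simp] theorem twist_inl (j i : ZMod m) (c : Idx m → K) :
    twist p j c (.inl i) = frob p j (c (.inl (i - j))) := by
  simp [twist, sub_eq_add_neg]

@[simp] theorem twist_inr (j i : ZMod m) (c : Idx m → K) :
    twist p j c (.inr i) = frob p j (c (.inr (i - j))) := by
  simp [twist, sub_eq_add_neg]

theorem frob_sum_coord [NeZero m] [Fintype K] (hK : Fintype.card K = p ^ m) (j : ZMod m)
    (c : Idx m → K) (u : K × K) :
    frob p j (∑ s, c s * coord p s u) = ∑ s, twist p j c s * coord p s u := by
  simp only [Fintype.sum_sum_type, twist_inl, twist_inr, coord_inl, coord_inr, map_add]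
  rw [map_sum, map_sum]
  simp only [map_mul, ← frob_add hK]
  congr 1
  · exact Fintype.sum_equiv (Equiv.addRight j) _ _ fun i => by simp [add_comm]
  · exact Fintype.sum_equiv (Equiv.addRight j) _ _ fun i => by simp [add_comm]

end Coordinates

/-! ### Coefficient matrices of rank two -/

section RankTwo

variable {ι K : Type*} [Field K] {C : ι → ι → K} {m₁ m₂ n₁ n₂ : ι → K}

/-- The `3 × 3` minors of a sum of two rank-one matrices vanish. -/
theorem minor_eq_zero (hC : ∀ s t, C s t = m₁ s * n₂ t + m₂ s * n₁ t) (s₁ s₂ s₃ t₁ t₂ t₃ : ι) :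
    C s₁ t₁ * (C s₂ t₂ * C s₃ t₃ - C s₂ t₃ * C s₃ t₂)
      - C s₁ t₂ * (C s₂ t₁ * C s₃ t₃ - C s₂ t₃ * C s₃ t₁)
      + C s₁ t₃ * (C s₂ t₁ * C s₃ t₂ - C s₂ t₂ * C s₃ t₁) = 0 := by
  simp only [hC]; ring

theorem row_eq_zero (hC : ∀ s t, C s t = m₁ s * n₂ t + m₂ s * n₁ t) {s₁ s₂ t₁ t₂ s : ι}
    (hdet : C s₁ t₁ * C s₂ t₂ - C s₁ t₂ * C s₂ t₁ ≠ 0) (hs : ∀ t, C s t = 0) :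
    m₁ s = 0 ∧ m₂ s = 0 := by
  have hn : n₂ t₁ * n₁ t₂ - n₂ t₂ * n₁ t₁ ≠ 0 := by
    intro h0
    apply hdet
    simp only [hC]
    linear_combination (m₁ s₁ * m₂ s₂ - m₂ s₁ * m₁ s₂) * h0
  have h1 := hs t₁
  have h2 := hs t₂
  rw [hC] at h1 h2
  constructor
  · refine (mul_eq_zero.1 ?_).resolve_right hn
    linear_combination n₁ t₂ * h1 - n₁ t₁ * h2
  · refine (mul_eq_zero.1 ?_).resolve_right hn
    linear_combination n₂ t₁ * h2 - n₂ t₂ * h1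

theorem column_eq_zero (hC : ∀ s t, C s t = m₁ s * n₂ t + m₂ s * n₁ t) {s₁ s₂ t₁ t₂ t : ι}
    (hdet : C s₁ t₁ * C s₂ t₂ - C s₁ t₂ * C s₂ t₁ ≠ 0) (ht : ∀ s, C s t = 0) :
    n₁ t = 0 ∧ n₂ t = 0 :=
  row_eq_zero (C := fun t s => C s t) (m₁ := n₁) (m₂ := n₂) (n₁ := m₁) (n₂ := m₂)
    (fun t s => by rw [hC]; ring) (s₁ := t₁) (s₂ := t₂) (t₁ := s₁) (t₂ := s₂)
    (by intro h; apply hdet; linear_combination h) ht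

end RankTwo

section Coefficients

variable {p m : ℕ} {K : Type*} [Field K] [Fact p.Prime] [CharP K p]

variable (p) in
/-- The coefficients of the bilinear form `(u, v) ↦ ψ (u * v)`, where `*` has the parameters `k`,
`r`, `α`, and where `ψ (x, y) = ∑ i, a i * x ^ (p ^ i) + ∑ i, b i * y ^ (p ^ i)`. -/
def formCoeff (k r : ZMod m) (α : K) (a b : ZMod m → K) : Idx m → Idx m → K
  | .inl i, .inl j => (if i = j + k then a j else 0) + (if j = i + k then a i else 0)
  | .inr i, .inr j => (if i = j + k then a (j - r) * frob p (j - r) α else 0) +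
      (if j = i + k then a (i - r) * frob p (i - r) α else 0)
  | .inl i, .inr j => if i = j then b i else 0
  | .inr i, .inl j => if i = j then b i else 0

variable {k r : ZMod m} {α : K} {a b : ZMod m → K}

theorem formCoeff_inl (hkk : k + k ≠ 0) (i : ZMod m) :
    formCoeff p k r α a b (.inl i) (.inl (i + k)) = a i := by
  have h : i ≠ i + k + k := by rwa [add_assoc, ne_comm, Ne, add_eq_left]
  simp [formCoeff, h]

theorem formCoeff_inl' (hkk : k + k ≠ 0) (i : ZMod m) :
    formCoeff p k r α a b (.inl (i + k)) (.inl i) = a i := by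
  have h : i ≠ i + k + k := by rwa [add_assoc, ne_comm, Ne, add_eq_left]
  simp [formCoeff, h]

theorem formCoeff_inl_self (hk : k ≠ 0) (i : ZMod m) :
    formCoeff p k r α a b (.inl i) (.inl i) = 0 := by
  simp [formCoeff, hk]

theorem formCoeff_inr (hkk : k + k ≠ 0) (i : ZMod m) :
    formCoeff p k r α a b (.inr (i + r)) (.inr (i + r + k)) = a i * frob p i α := by
  have h : i + r ≠ i + r + k + k := by rwa [add_assoc (i + r), ne_comm, Ne, add_eq_left]
  simp [formCoeff, h]

/-- A nonzero coefficient `a i` determines the whole matrix if the latter has rank two: its entries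
in the rows and columns `inl i`, `inl (i + k)` form an antidiagonal invertible block. -/
theorem formCoeff_eq_of_rank {m₁ m₂ n₁ n₂ : Idx m → K} (hk : k ≠ 0) (hkk : k + k ≠ 0)
    (hC : ∀ s t, formCoeff p k r α a b s t = m₁ s * n₂ t + m₂ s * n₁ t) {i : ZMod m}
    (hi : a i ≠ 0) (s t : Idx m) :
    a i * formCoeff p k r α a b s t =
      formCoeff p k r α a b s (.inl (i + k)) * formCoeff p k r α a b (.inl i) t +
      formCoeff p k r α a b s (.inl i) * formCoeff p k r α a b (.inl (i + k)) t := by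
  have h := minor_eq_zero hC (.inl i) (.inl (i + k)) s (.inl (i + k)) (.inl i) t
  rw [formCoeff_inl hkk, formCoeff_inl' hkk, formCoeff_inl_self hk, formCoeff_inl_self hk] at h
  apply mul_left_cancel₀ hi
  linear_combination h

/-- In rank two, a nonzero `a i` is possible only for `r = 0`, and then the nonzero `b j` are
`b i` and `b (i + k)`. -/
theorem coeff_of_rank {m₁ m₂ n₁ n₂ : Idx m → K} (hα : α ≠ 0) (hk : k ≠ 0) (hkk : k + k ≠ 0)
    (hC : ∀ s t, formCoeff p k r α a b s t = m₁ s * n₂ t + m₂ s * n₁ t) {i : ZMod m}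
    (hi : a i ≠ 0) :
    r = 0 ∧ b i ≠ 0 ∧ b (i + k) ≠ 0 ∧ ∀ j, j ≠ i → j ≠ i + k → b j = 0 := by
  have h := formCoeff_eq_of_rank hk hkk hC hi
  have hik : i + k ≠ i := by rwa [Ne, add_eq_left]
  have hr : r = 0 := by
    have h1 := h (.inr (i + r)) (.inr (i + r + k))
    rw [formCoeff_inr hkk] at h1
    by_contra hr
    have hir : i + r ≠ i := by rwa [Ne, add_eq_left]
    have hirk : i + k ≠ i + r + k := by
      intro h2; apply hr; linear_combination -h2
    have h3 : ¬ (i + r = i + k ∧ i = i + r + k) := by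
      rintro ⟨h4, h5⟩; apply hkk; linear_combination -h5 - h4
    have hα' : frob p i α ≠ 0 := by simpa using hα
    have h6 : a i * (a i * frob p i α) ≠ 0 := mul_ne_zero hi (mul_ne_zero hi hα')
    apply h6
    rw [h1]
    simp only [formCoeff, if_neg hir, if_neg hirk]
    by_cases h4 : i + r = i + k
    · rw [if_neg (fun h5 => h3 ⟨h4, h5⟩)]; ring
    · rw [if_neg h4]; ring
  subst hr
  have h1 := h (.inr i) (.inr (i + k))
  have h2 := formCoeff_inr (p := p) (r := 0) (α := α) (a := a) (b := b) hkk i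
  rw [add_zero] at h2
  rw [h2] at h1
  have hα' : frob p i α ≠ 0 := by simpa using hα
  have h6 : a i * (a i * frob p i α) ≠ 0 := mul_ne_zero hi (mul_ne_zero hi hα')
  rw [h1] at h6
  simp only [formCoeff, if_neg hik.symm, zero_mul, zero_add] at h6
  refine ⟨rfl, ?_, ?_, fun j hj hjk => ?_⟩
  · intro h0; apply h6; simp [h0]
  · intro h0; apply h6; simp [h0]
  · have h7 := h (.inl j) (.inr j)
    simp only [formCoeff, if_neg (Ne.symm hj), if_neg (Ne.symm hjk)] at h7
    simpa [hi] using h7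

/-- In rank two, if all `a i` vanish then at most one `b i` does not. -/
theorem unique_of_rank {m₁ m₂ n₁ n₂ : Idx m → K} (ha : ∀ i, a i = 0)
    (hC : ∀ s t, formCoeff p k r α a b s t = m₁ s * n₂ t + m₂ s * n₁ t) {i j : ZMod m}
    (hi : b i ≠ 0) (hij : j ≠ i) : b j = 0 := by
  have h := minor_eq_zero hC (.inl i) (.inr i) (.inl j) (.inr i) (.inl i) (.inr j)
  simp only [formCoeff, ha, hij, hij.symm, if_true, if_false, zero_mul, ite_self, add_zero] at h
  simpa [hi] using h

/-- Coefficients of the first component of `M u * N v`, where `M = (M₁, M₂)` and `N = (N₁, N₂)`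
have the coefficients `m₁, m₂` and `n₁, n₂`. -/
def productCoeff (p : ℕ) [Fact p.Prime] [CharP K p] (k r : ZMod m) (α : K)
    (m₁ m₂ n₁ n₂ : Idx m → K) (s t : Idx m) : K :=
  twist p k m₁ s * n₁ t + m₁ s * twist p k n₁ t +
    α * (twist p (r + k) m₂ s * twist p r n₂ t + twist p r m₂ s * twist p (r + k) n₂ t)

/-- If the second component of `L` involves only the coordinate `j` of the second component of its
argument, then `M` and `N` involve only the coordinates `inl j` and `inr j`, and a comparison of the
exponents in the first component determines the parameters. -/
theorem parameters_of_single {k' r' : ZMod m} {α' : K} {m₁ m₂ n₁ n₂ : Idx m → K}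
    {a₁ b₁ : ZMod m → K} (hα' : α' ≠ 0) (hkk' : k' + k' ≠ 0) (hadd : k + k' ≠ 0)
    (hC : ∀ s t, formCoeff p k' r' α' a b s t = m₁ s * n₂ t + m₂ s * n₁ t)
    (hD : ∀ s t, formCoeff p k' r' α' a₁ b₁ s t = productCoeff p k r α m₁ m₂ n₁ n₂ s t)
    (ha : ∀ i, a i = 0) {j : ZMod m} (hj : b j ≠ 0) (hb : ∀ i, i ≠ j → b i = 0)
    {i : ZMod m} (hi : a₁ i ≠ 0) :
    k' = k ∧ (r' = 0 ∨ r' = r ∨ r' = -r) := by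
  have hdet :
      formCoeff p k' r' α' a b (.inl j) (.inr j) * formCoeff p k' r' α' a b (.inr j) (.inl j)
      - formCoeff p k' r' α' a b (.inl j) (.inl j) * formCoeff p k' r' α' a b (.inr j) (.inr j)
      ≠ 0 := by
    simp [formCoeff, ha, hj]
  have hml : ∀ i, i ≠ j → m₁ (.inl i) = 0 ∧ m₂ (.inl i) = 0 := fun i hi =>
    row_eq_zero hC hdet (by rintro (l | l) <;> simp [formCoeff, ha, hb i hi])
  have hmr : ∀ i, i ≠ j → m₁ (.inr i) = 0 ∧ m₂ (.inr i) = 0 := fun i hi =>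
    row_eq_zero hC hdet (by rintro (l | l) <;> simp [formCoeff, ha, hb i hi])
  have hdet' :
      formCoeff p k' r' α' a b (.inl j) (.inl j) * formCoeff p k' r' α' a b (.inr j) (.inr j)
      - formCoeff p k' r' α' a b (.inl j) (.inr j) * formCoeff p k' r' α' a b (.inr j) (.inl j)
      ≠ 0 := by
    simp [formCoeff, ha, hj]
  have hnl : ∀ i, i ≠ j → n₁ (.inl i) = 0 ∧ n₂ (.inl i) = 0 := fun i hi =>
    column_eq_zero hC hdet' (by
      rintro (l | l)
      all_goals simp only [formCoeff, ha, ite_self, add_zero]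
      exact ite_eq_right_iff.2 fun h => h ▸ hb i hi)
  have hnr : ∀ i, i ≠ j → n₁ (.inr i) = 0 ∧ n₂ (.inr i) = 0 := fun i hi =>
    column_eq_zero hC hdet' (by
      rintro (l | l)
      all_goals simp only [formCoeff, ha, zero_mul, ite_self, add_zero]
      exact ite_eq_right_iff.2 fun h => h ▸ hb i hi)
  -- the pairs of exponents that occur in the first component of `M u * N v`
  have key : ∀ s t, productCoeff p k r α m₁ m₂ n₁ n₂ s t ≠ 0 → ∀ i l,
      (s = .inl i ∨ s = .inr i) → (t = .inl l ∨ t = .inr l) →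
      (i - k = j ∧ l = j) ∨ (i = j ∧ l - k = j) ∨ (i - (r + k) = j ∧ l - r = j) ∨
        (i - r = j ∧ l - (r + k) = j) := by
    intro s t hst i l hs ht
    by_contra hcon
    simp only [not_or, not_and_or] at hcon
    obtain ⟨h1, h2, h3, h4⟩ := hcon
    have hm1 : ∀ c, i - c ≠ j → twist p c m₁ s = 0 ∧ twist p c m₂ s = 0 := by
      intro c hc; rcases hs with rfl | rfl <;> simp [hml _ hc, hmr _ hc]
    have hn1 : ∀ c, l - c ≠ j → twist p c n₁ t = 0 ∧ twist p c n₂ t = 0 := by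
      intro c hc; rcases ht with rfl | rfl <;> simp [hnl _ hc, hnr _ hc]
    have hm0 : i ≠ j → m₁ s = 0 := by
      intro hc; rcases hs with rfl | rfl <;> simp [hml _ hc, hmr _ hc]
    have hn0 : l ≠ j → n₁ t = 0 := by
      intro hc; rcases ht with rfl | rfl <;> simp [hnl _ hc, hnr _ hc]
    have e1 : twist p k m₁ s * n₁ t = 0 := by
      rcases h1 with h | h
      · rw [(hm1 _ h).1, zero_mul]
      · rw [hn0 h, mul_zero]
    have e2 : m₁ s * twist p k n₁ t = 0 := by
      rcases h2 with h | h
      · rw [hm0 h, zero_mul]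
      · rw [(hn1 _ h).1, mul_zero]
    have e3 : twist p (r + k) m₂ s * twist p r n₂ t = 0 := by
      rcases h3 with h | h
      · rw [(hm1 _ h).2, zero_mul]
      · rw [(hn1 _ h).2, mul_zero]
    have e4 : twist p r m₂ s * twist p (r + k) n₂ t = 0 := by
      rcases h4 with h | h
      · rw [(hm1 _ h).2, zero_mul]
      · rw [(hn1 _ h).2, mul_zero]
    apply hst
    rw [productCoeff, e1, e2, e3, e4]; ring
  have key2 : ∀ i, (i - k = j ∧ i + k' = j) ∨ (i = j ∧ i + k' - k = j) ∨
      (i - (r + k) = j ∧ i + k' - r = j) ∨ (i - r = j ∧ i + k' - (r + k) = j) →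
      k' = k ∧ (i = j ∨ i = j + r) := by
    rintro i (⟨h1, h2⟩ | ⟨h1, h2⟩ | ⟨h1, h2⟩ | ⟨h1, h2⟩)
    · exact absurd (by linear_combination h2 - h1) hadd
    · exact ⟨by linear_combination h2 - h1, .inl h1⟩
    · exact absurd (by linear_combination h2 - h1) hadd
    · exact ⟨by linear_combination h2 - h1, .inr (by linear_combination h1)⟩
  have hx := key (.inl i) (.inl (i + k')) (by rwa [← hD, formCoeff_inl hkk']) i (i + k')
    (.inl rfl) (.inl rfl)
  have hy := key (.inr (i + r')) (.inr (i + r' + k'))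
    (by rw [← hD, formCoeff_inr hkk']; exact mul_ne_zero hi (by simpa using hα'))
    (i + r') (i + r' + k') (.inr rfl) (.inr rfl)
  obtain ⟨hk, hi1⟩ := key2 _ hx
  obtain ⟨-, hi2⟩ := key2 _ hy
  refine ⟨hk, ?_⟩
  rcases hi1 with h1 | h1 <;> rcases hi2 with h2 | h2
  · exact .inl (by linear_combination h2 - h1)
  · exact .inr (.inl (by linear_combination h2 - h1))
  · exact .inr (.inr (by linear_combination h2 - h1))
  · exact .inl (by linear_combination h2 - h1)

/-- For `r = r' = 0` the second component of `L` does not involve the first component of its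
argument: otherwise a mixed coefficient of the first component of `M u * N v` would make `α` a
square. -/
theorem first_coeff_eq_zero [NeZero m] [Fintype K] (hK : Fintype.card K = p ^ m)
    {k' : ZMod m} {α' : K} {m₁ m₂ n₁ n₂ : Idx m → K}
    {a₁ b₁ : ZMod m → K} (hα : ¬ IsSquare α) (hα' : α' ≠ 0) (hp : p ≠ 2)
    (hk : k ≠ 0) (hk' : k' ≠ 0) (hkk' : k' + k' ≠ 0) (hadd : k + k' ≠ 0)
    (hC : ∀ s t, formCoeff p k' 0 α' a b s t = m₁ s * n₂ t + m₂ s * n₁ t)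
    (hD : ∀ s t, formCoeff p k' 0 α' a₁ b₁ s t = productCoeff p k 0 α m₁ m₂ n₁ n₂ s t)
    (i : ZMod m) : a i = 0 := by
  by_contra hi
  obtain ⟨-, hbi, hbik, hb⟩ := coeff_of_rank hα' hk' hkk' hC hi
  have ha : ∀ j, j ≠ i → a j = 0 := by
    intro j hj
    by_contra haj
    obtain ⟨-, h1, h2, -⟩ := coeff_of_rank hα' hk' hkk' hC haj
    have h3 : j = i + k' := by by_contra h; exact h1 (hb j hj h)
    subst h3
    refine h2 (hb _ (fun h => hkk' ?_) (fun h => hk' ?_))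
    · linear_combination h
    · linear_combination h
  have hdet : formCoeff p k' 0 α' a b (.inl i) (.inl (i + k')) *
        formCoeff p k' 0 α' a b (.inl (i + k')) (.inl i)
      - formCoeff p k' 0 α' a b (.inl i) (.inl i) *
        formCoeff p k' 0 α' a b (.inl (i + k')) (.inl (i + k')) ≠ 0 := by
    rw [formCoeff_inl hkk', formCoeff_inl' hkk', formCoeff_inl_self hk']
    simpa using hi
  have hn : n₁ (.inr (i + k + k')) = 0 ∧ n₂ (.inr (i + k + k')) = 0 := by
    have h1 : i + k + k' ≠ i := fun h => hadd (by linear_combination h)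
    have h2 : i + k + k' ≠ i + k' := fun h => hk (by linear_combination h)
    refine column_eq_zero hC (s₁ := .inl i) (s₂ := .inl (i + k')) (t₁ := .inl (i + k'))
      (t₂ := .inl i) hdet ?_
    rintro (l | l)
    · simp only [formCoeff]
      split_ifs with h
      · subst h; exact hb _ h1 h2
      · rfl
    · simp only [formCoeff, sub_zero]
      rw [ha _ h1, zero_mul, ite_self, zero_add]
      split_ifs with h
      · have : l ≠ i := by rintro rfl; exact h2 h
        rw [ha _ this, zero_mul]
      · rfl
  -- the mixed coefficient at `inl i`, `inr (i + k + k')`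
  have hmix := hD (.inl i) (.inr (i + k + k'))
  have hne : i ≠ i + k + k' := fun h => hadd (by linear_combination -h)
  have hsub : i + k + k' - k = i + k' := by ring
  simp only [formCoeff, productCoeff, if_neg hne, twist_inl, twist_inr, hn.1, hn.2, sub_zero,
    zero_add, mul_zero, hsub, frob_zero hK] at hmix
  have hCiy := hC (.inl i) (.inr (i + k'))
  rw [formCoeff, if_neg (fun h => hk' (by linear_combination -h))] at hCiy
  have hrow := hC (.inl i) (.inl (i + k'))
  rw [formCoeff_inl hkk'] at hrow
  have hcol := hC (.inr (i + 0)) (.inr (i + 0 + k'))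
  rw [formCoeff_inr hkk', add_zero] at hcol
  have hcol0 : a i * frob p i α' ≠ 0 := mul_ne_zero hi (by simpa using hα')
  set A := m₁ (.inl i)
  set B := m₂ (.inl i)
  set U := n₁ (.inr (i + k'))
  set V := n₂ (.inr (i + k'))
  have hα0 : α ≠ 0 := by rintro rfl; exact hα (IsSquare.zero)
  have hA : A ≠ 0 := by
    intro hA
    rw [hA] at hCiy hmix hrow
    have hB : B ≠ 0 := by intro hB; rw [hB] at hrow; apply hi; rw [hrow]; ring
    have hU : U = 0 := by simpa [hB] using hCiy.symm
    have hV : V = 0 := by simpa [hB, hα0] using hmix.symm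
    rw [hU, hV] at hcol
    apply hcol0; rw [hcol]; ring
  have hU : U ≠ 0 := by
    intro hU
    rw [hU] at hCiy hmix hcol
    have hV : V = 0 := by simpa [hA] using hCiy.symm
    rw [hV] at hcol
    apply hcol0; rw [hcol]; ring
  have hodd : Odd (p ^ k.val) := ((Fact.out : p.Prime).odd_of_ne_two hp).pow
  have hF : ∀ x : K, frob p k x = x ^ p ^ k.val := fun x => iterateFrobenius_def p k.val x
  have hV : A * V = - (B * U) := by linear_combination -hCiy
  have hV' := congrArg (frob p k) hV
  rw [map_mul, map_neg, map_mul] at hV'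
  have h1 : A * frob p k A = α * (B * frob p k B) := by
    apply mul_right_cancel₀ (b := frob p k U) (by simpa using hU)
    linear_combination -frob p k A * hmix - α * B * hV'
  obtain ⟨c, hc⟩ : Even (p ^ k.val + 1) := hodd.add_one
  have h2 : ∀ x : K, x * frob p k x = x ^ c * x ^ c := by
    intro x; rw [hF, ← pow_add, ← hc, pow_succ']
  have hB : B ≠ 0 := by
    intro hB
    rw [hB] at hV
    have : V = 0 := by simpa [hA] using hV
    rw [hB] at h1
    simp [hA] at h1
  refine hα ⟨A ^ c / B ^ c, ?_⟩
  rw [h2, h2] at h1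
  field_simp
  linear_combination -h1

end Coefficients

/-! ### Rigidity of isotopisms -/

section Isotopism

variable {p m : ℕ} {K : Type*} [Field K] [Fact p.Prime] [CharP K p]

theorem sum_adjacent [NeZero m] (k : ZMod m) (f : ZMod m → K) (x z : K) :
    ∑ i, ∑ j, ((if i = j + k then f j else 0) + (if j = i + k then f i else 0)) *
        (frob p i x * frob p j z) =
      ∑ i, f i * (frob p (i + k) x * frob p i z + frob p i x * frob p (i + k) z) := by
  simp only [add_mul, mul_add, Finset.sum_add_distrib]
  congr 1
  · rw [Finset.sum_comm]
    simp
  · simp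

theorem natCast_ne_zero_of_lt {n : ℕ} (h0 : 0 < n) (h : n < m) : (n : ZMod m) ≠ 0 := by
  rw [Ne, ZMod.natCast_eq_zero_iff]
  exact fun hd => absurd (Nat.le_of_dvd h0 hd) (by omega)

theorem sum_mul_sum_coord [NeZero m] (c d : Idx m → K) (u v : K × K) :
    (∑ s, c s * coord p s u) * (∑ t, d t * coord p t v) =
      ∑ s, ∑ t, c s * d t * (coord p s u * coord p t v) := by
  rw [Finset.sum_mul_sum]
  exact Finset.sum_congr rfl fun s _ => Finset.sum_congr rfl fun t _ => by ring

variable [NeZero m] [Fintype K]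

theorem frob_circ (hK : Fintype.card K = p ^ m) (i : ZMod m) (k : ℕ) (x z : K) :
    frob p i (circ p k x z) =
      frob p (i + (k : ZMod m)) x * frob p i z + frob p i x * frob p (i + (k : ZMod m)) z := by
  rw [circ, ← frob_natCast hK, ← frob_natCast hK, frob_add hK, frob_add hK, map_add, map_mul,
    map_mul]
  ring

theorem sum_coord_preMul (hK : Fintype.card K = p ^ m) (k r : ℕ) (α : K) (c : Idx m → K)
    (u v : K × K) :
    ∑ s, c s * coord p s (preMul p k r α u v) =
      ∑ s, ∑ t, formCoeff p (k : ZMod m) r α (fun i => c (.inl i)) (fun i => c (.inr i)) s t *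
        (coord p s u * coord p t v) := by
  simp only [Fintype.sum_sum_type, formCoeff, coord_inl, coord_inr, Finset.sum_add_distrib,
    sum_adjacent]
  have h1 : ∀ i : ZMod m, c (.inl i) * frob p i (preMul p k r α u v).1 =
      c (.inl i) * (frob p (i + (k : ZMod m)) u.1 * frob p i v.1 +
        frob p i u.1 * frob p (i + (k : ZMod m)) v.1) +
      c (.inl i) * frob p i α *
        (frob p (i + (r : ZMod m) + (k : ZMod m)) u.2 * frob p (i + (r : ZMod m)) v.2 +
        frob p (i + (r : ZMod m)) u.2 * frob p (i + (r : ZMod m) + (k : ZMod m)) v.2) := by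
    intro i
    rw [preMul, ← frob_natCast hK r, map_add, map_mul, ← frob_add hK, frob_circ hK, frob_circ hK]
    ring
  have h2 : ∀ i : ZMod m, c (.inr i) * frob p i (preMul p k r α u v).2 =
      c (.inr i) * (frob p i u.1 * frob p i v.2) + c (.inr i) * (frob p i u.2 * frob p i v.1) := by
    intro i
    rw [preMul, map_add, map_mul, map_mul]
    ring
  simp only [h1, h2, Finset.sum_add_distrib]
  have h3 : ∑ i : ZMod m, c (.inl i) * frob p i α *
        (frob p (i + (r : ZMod m) + (k : ZMod m)) u.2 * frob p (i + (r : ZMod m)) v.2 +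
        frob p (i + (r : ZMod m)) u.2 * frob p (i + (r : ZMod m) + (k : ZMod m)) v.2) =
      ∑ i : ZMod m, c (.inl (i - (r : ZMod m))) * frob p (i - (r : ZMod m)) α *
        (frob p (i + (k : ZMod m)) u.2 * frob p i v.2 +
          frob p i u.2 * frob p (i + (k : ZMod m)) v.2) :=
    Fintype.sum_equiv (Equiv.addRight (r : ZMod m)) _ _ fun i => by simp
  rw [h3]
  simp only [ite_mul, zero_mul, Finset.sum_ite_eq, Finset.mem_univ, if_true]
  ring

theorem preMul_sum_coord (hK : Fintype.card K = p ^ m) (k r : ℕ) (α : K)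
    (m₁ m₂ n₁ n₂ : Idx m → K) (u v : K × K) :
    preMul p k r α (∑ s, m₁ s * coord p s u, ∑ s, m₂ s * coord p s u)
        (∑ t, n₁ t * coord p t v, ∑ t, n₂ t * coord p t v) =
      (∑ s, ∑ t, productCoeff p (k : ZMod m) r α m₁ m₂ n₁ n₂ s t * (coord p s u * coord p t v),
        ∑ s, ∑ t, (m₁ s * n₂ t + m₂ s * n₁ t) * (coord p s u * coord p t v)) := by
  have h0 : ∀ x z : K, circ p k x z = frob p (0 + (k : ZMod m)) x * z +
      x * frob p (0 + (k : ZMod m)) z := by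
    intro x z
    simpa only [frob_zero hK] using frob_circ hK 0 k x z
  rw [preMul, ← frob_natCast hK r, frob_circ hK, h0]
  simp only [zero_add, frob_sum_coord hK, sum_mul_sum_coord]
  simp only [productCoeff, add_mul, mul_add, Finset.sum_add_distrib, Finset.mul_sum, mul_assoc]

/-- The rigidity of isotopisms `M u * N v = L (u *' v)` between members of the family (with
`r' ≠ 0`, or `r = r' = 0`): the second component of `L` is a monomial in the second component of its
argument, and the parameters agree up to the sign of `r'` modulo `m`. -/
theorem isotopism_rigid [Algebra (ZMod p) K] (hp : p ≠ 2) (hK : Fintype.card K = p ^ m)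
    {k r k' r' : ℕ} {α α' : K} (hα : ¬ IsSquare α) (hα' : ¬ IsSquare α')
    (hk : 0 < k) (hkm : 2 * k < m) (hk' : 0 < k') (hkm' : 2 * k' < m)
    (hr : (r' : ZMod m) ≠ 0 ∨ (r = 0 ∧ r' = 0))
    (M N L : (K × K) ≃ₗ[ZMod p] K × K)
    (h : ∀ u v, preMul p k r α (M u) (N v) = L (preMul p k' r' α' u v)) :
    ((k' : ZMod m) = k ∧ ((r' : ZMod m) = 0 ∨ (r' : ZMod m) = r ∨ (r' : ZMod m) = -r)) ∧
      ∃ (j : ZMod m) (b : K), b ≠ 0 ∧ ∀ w, (L w).2 = b * frob p j w.2 := by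
  have hα0 : α' ≠ 0 := by rintro rfl; exact hα' IsSquare.zero
  have hk0 := natCast_ne_zero_of_lt (m := m) hk (by omega)
  have hk0' := natCast_ne_zero_of_lt (m := m) hk' (by omega)
  have hkk' : (k' : ZMod m) + k' ≠ 0 := by
    exact_mod_cast natCast_ne_zero_of_lt (m := m) (n := k' + k') (by omega) (by omega)
  have hadd : (k : ZMod m) + k' ≠ 0 := by
    exact_mod_cast natCast_ne_zero_of_lt (m := m) (n := k + k') (by omega) (by omega)
  obtain ⟨m₁, hm₁⟩ := exists_coeff hK (LinearMap.fst (ZMod p) K K ∘ₗ M.toLinearMap)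
  obtain ⟨m₂, hm₂⟩ := exists_coeff hK (LinearMap.snd (ZMod p) K K ∘ₗ M.toLinearMap)
  obtain ⟨n₁, hn₁⟩ := exists_coeff hK (LinearMap.fst (ZMod p) K K ∘ₗ N.toLinearMap)
  obtain ⟨n₂, hn₂⟩ := exists_coeff hK (LinearMap.snd (ZMod p) K K ∘ₗ N.toLinearMap)
  obtain ⟨l₁, hl₁⟩ := exists_coeff hK (LinearMap.fst (ZMod p) K K ∘ₗ L.toLinearMap)
  obtain ⟨l₂, hl₂⟩ := exists_coeff hK (LinearMap.snd (ZMod p) K K ∘ₗ L.toLinearMap)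
  simp only [LinearMap.coe_comp, Function.comp_apply, LinearMap.fst_apply, LinearMap.snd_apply,
    LinearEquiv.coe_coe] at hm₁ hm₂ hn₁ hn₂ hl₁ hl₂
  have hM : ∀ u, M u = (∑ s, m₁ s * coord p s u, ∑ s, m₂ s * coord p s u) := fun u =>
    Prod.ext (hm₁ u) (hm₂ u)
  have hN : ∀ u, N u = (∑ s, n₁ s * coord p s u, ∑ s, n₂ s * coord p s u) := fun u =>
    Prod.ext (hn₁ u) (hn₂ u)
  have hprod := fun u v => (h u v).symm
  simp only [hM, hN, preMul_sum_coord hK] at hprod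
  have hD : ∀ s t,
      formCoeff p (k' : ZMod m) r' α' (fun i => l₁ (.inl i)) (fun i => l₁ (.inr i)) s t =
      productCoeff p (k : ZMod m) r α m₁ m₂ n₁ n₂ s t := by
    refine fun s t => congrFun (congrFun (bilinear_coeff_unique hK (c := formCoeff p (k' : ZMod m)
      r' α' (fun i => l₁ (.inl i)) (fun i => l₁ (.inr i)))
      (d := fun s t => productCoeff p (k : ZMod m) r α m₁ m₂ n₁ n₂ s t) fun u v => ?_) s) t
    rw [← sum_coord_preMul hK, ← hl₁, hprod]
  have hC : ∀ s t,
      formCoeff p (k' : ZMod m) r' α' (fun i => l₂ (.inl i)) (fun i => l₂ (.inr i)) s t =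
      m₁ s * n₂ t + m₂ s * n₁ t := by
    refine fun s t => congrFun (congrFun (bilinear_coeff_unique hK (c := formCoeff p (k' : ZMod m)
      r' α' (fun i => l₂ (.inl i)) (fun i => l₂ (.inr i)))
      (d := fun s t => m₁ s * n₂ t + m₂ s * n₁ t) fun u v => ?_) s) t
    rw [← sum_coord_preMul hK, ← hl₂, hprod]
  have ha : ∀ i, l₂ (.inl i) = 0 := by
    intro i
    rcases hr with hr | ⟨rfl, rfl⟩
    · by_contra hi
      exact hr (coeff_of_rank hα0 hk0' hkk' hC hi).1
    · rw [Nat.cast_zero] at hC hD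
      exact first_coeff_eq_zero hK hα hα0 hp hk0 hk0' hkk' hadd hC hD i
  obtain ⟨j, hj⟩ : ∃ j, l₂ (.inr j) ≠ 0 := by
    by_contra hcon
    push Not at hcon
    obtain ⟨w, hw⟩ := L.surjective (0, 1)
    have := hl₂ w
    simp [Fintype.sum_sum_type, ha, hcon, hw] at this
  have hb : ∀ i, i ≠ j → l₂ (.inr i) = 0 := fun i hij => unique_of_rank ha hC hj hij
  obtain ⟨i, hi⟩ : ∃ i, l₁ (.inl i) ≠ 0 := by
    by_contra hcon
    push Not at hcon
    have h1 := hl₁ (1, 0)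
    have h2 := hl₂ (1, 0)
    simp [Fintype.sum_sum_type, ha, hcon] at h1 h2
    have h3 : L (1, 0) = 0 := Prod.ext h1 h2
    simp at h3
  refine ⟨parameters_of_single hα0 hkk' hadd hC hD ha hj hb hi, j, l₂ (.inr j), hj, fun w => ?_⟩
  rw [hl₂ w, Fintype.sum_sum_type, Finset.sum_eq_zero (fun i _ => by rw [ha, zero_mul]), zero_add,
    Finset.sum_eq_single j (fun i _ hij => by rw [hb i hij, zero_mul]) (by simp), coord_inr]

end Isotopism

/-! ### The members of the family are commutative semifields -/

section Presemifield

variable {V : Type*} [AddCommGroup V]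

theorem isPresemifield_of_finite [Finite V] {mul : V → V → V}
    (hadd : ∀ a b c, mul (a + b) c = mul a c + mul b c)
    (hadd' : ∀ a b c, mul a (b + c) = mul a b + mul a c)
    (hne : ∀ a b, a ≠ 0 → b ≠ 0 → mul a b ≠ 0) : IsPresemifield mul := by
  have h0 : ∀ a, mul 0 a = 0 := fun a => by simpa using hadd 0 0 a
  have h0' : ∀ a, mul a 0 = 0 := fun a => by simpa using hadd' a 0 0
  have hL : ∀ a, a ≠ 0 → Function.Bijective (mul a) := fun a ha =>
    Finite.injective_iff_bijective.1 <|
      (injective_iff_map_eq_zero (AddMonoidHom.mk' (mul a) (hadd' a))).2 fun x hx => by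
        by_contra hx0; exact hne a x ha hx0 hx
  have hR : ∀ a, a ≠ 0 → Function.Bijective (fun x => mul x a) := fun a ha =>
    Finite.injective_iff_bijective.1 <|
      (injective_iff_map_eq_zero (AddMonoidHom.mk' (fun x => mul x a) fun x y => hadd x y a)).2
        fun x hx => by by_contra hx0; exact hne x a hx0 ha hx
  refine ⟨hadd, hadd', h0, h0', hne, fun a b ha hb => ?_, fun a b ha hb => ?_⟩
  · obtain ⟨x, hx⟩ := (hL a ha).2 b
    exact ⟨x, ⟨by rintro rfl; exact hb (by rw [← hx, h0']), hx⟩,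
      fun y hy => (hL a ha).1 (hy.2.trans hx.symm)⟩
  · obtain ⟨x, hx⟩ := (hR a ha).2 b
    exact ⟨x, ⟨by rintro rfl; exact hb (by rw [← hx]; exact h0 a), hx⟩,
      fun y hy => (hR a ha).1 (hy.2.trans hx.symm)⟩

theorem Isotopic.isPresemifield {p : ℕ} [Module (ZMod p) V] [Finite V] {mul₁ mul₂ : V → V → V}
    (h : Isotopic p mul₁ mul₂) (h₁ : IsPresemifield mul₁) : IsPresemifield mul₂ := by
  obtain ⟨M, N, L, h⟩ := h
  have h' : ∀ x y, mul₂ x y = L (mul₁ (M.symm x) (N.symm y)) := fun x y => by simp [← h]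
  refine isPresemifield_of_finite (fun a b c => ?_) (fun a b c => ?_) (fun a b ha hb => ?_)
  · simp only [h', map_add, h₁.add_mul]
  · simp only [h', map_add, h₁.mul_add]
  · rw [h', Ne, L.map_eq_zero_iff]
    exact h₁.mul_ne_zero _ _ (by simpa using ha) (by simpa using hb)

theorem Isotopic.refl (p : ℕ) [Module (ZMod p) V] (mul : V → V → V) : Isotopic p mul mul :=
  ⟨.refl _ _, .refl _ _, .refl _ _, fun _ _ => rfl⟩

theorem Isotopic.symm {p : ℕ} [Module (ZMod p) V] {mul₁ mul₂ : V → V → V}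
    (h : Isotopic p mul₁ mul₂) : Isotopic p mul₂ mul₁ := by
  obtain ⟨M, N, L, h⟩ := h
  exact ⟨M.symm, N.symm, L.symm, fun x y => by simp [LinearEquiv.eq_symm_apply, ← h]⟩

theorem Isotopic.trans {p : ℕ} [Module (ZMod p) V] {mul₁ mul₂ mul₃ : V → V → V}
    (h : Isotopic p mul₁ mul₂) (h' : Isotopic p mul₂ mul₃) : Isotopic p mul₁ mul₃ := by
  obtain ⟨M, N, L, h⟩ := h
  obtain ⟨M', N', L', h'⟩ := h'
  exact ⟨M.trans M', N.trans N', L.trans L', fun x y => by simp [h', h]⟩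

/-- The difference map of `x ↦ x * x` in the direction `a` is `x ↦ 2 (x * a) + a * a`. -/
theorem IsPresemifield.isPlanar [Finite V] {mul : V → V → V} (h : IsPresemifield mul)
    (hc : IsCommMul mul) (h2 : ∀ x : V, x + x = 0 → x = 0) : IsPlanar fun x => mul x x := by
  intro a ha
  refine Finite.injective_iff_bijective.1 fun x y hxy => ?_
  have h3 : ∀ x, mul (x + a) (x + a) - mul x x = mul x a + mul x a + mul a a := by
    intro x
    rw [h.add_mul, h.mul_add, h.mul_add, hc a x]; abel
  simp only [h3] at hxy
  have h4 : mul (x - y) a = 0 := by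
    have h5 : mul (x - y) a = mul x a - mul y a := by
      rw [eq_sub_iff_add_eq, ← h.add_mul, sub_add_cancel]
    apply h2
    rw [h5]
    have := add_right_cancel hxy
    rw [sub_add_sub_comm, this, sub_self]
  by_contra hne
  exact h.mul_ne_zero _ _ (sub_ne_zero.2 hne) ha h4

end Presemifield

section Construction

variable {p m : ℕ} {K : Type*} [Field K]

theorem preMul_comm (k r : ℕ) (α : K) (u v : K × K) :
    preMul p k r α u v = preMul p k r α v u := by
  simp only [preMul, circ, Prod.mk.injEq]
  constructor
  · ring
  · ring

theorem circ_mul (k : ℕ) (b z : K) : circ p k b (b * z) = b ^ (p ^ k + 1) * (z + z ^ p ^ k) := by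
  rw [circ]; ring

theorem semiMul_comm (k r : ℕ) (α : K) : IsCommMul (semiMul p k r α) :=
  fun _ _ => preMul_comm _ _ _ _ _

/-- The order of `x ↦ x ^ (p ^ k)` divides `m / gcd m k`. -/
theorem pow_pow_div_gcd [Fintype K] (hK : Fintype.card K = p ^ m) (k : ℕ) (x : K) :
    x ^ (p ^ k) ^ (m / m.gcd k) = x := by
  have h : k * (m / m.gcd k) = m * (k / m.gcd k) := by
    rw [← Nat.mul_div_assoc _ (Nat.gcd_dvd_left m k), ← Nat.mul_div_assoc _ (Nat.gcd_dvd_right m k),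
      mul_comm]
  rw [← pow_mul, h, pow_mul, ← hK, FiniteField.pow_card_pow]

theorem two_ne_zero_of_char [CharP K p] (hp : p ≠ 2) : (2 : K) ≠ 0 :=
  Ring.two_ne_zero (by rwa [ringChar.eq K p])

theorem odd_of_card [Fact p.Prime] (hp : p ≠ 2) (k : ℕ) : Odd (p ^ k) :=
  ((Fact.out : p.Prime).odd_of_ne_two hp).pow

variable [Fact p.Prime] [CharP K p]

theorem circ_add (k : ℕ) (x y z : K) : circ p k x (y + z) = circ p k x y + circ p k x z := by
  rw [circ, circ, circ, add_pow_char_pow]; ring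

theorem preMul_add (k r : ℕ) (α : K) (u v w : K × K) :
    preMul p k r α u (v + w) = preMul p k r α u v + preMul p k r α u w := by
  simp only [preMul, Prod.fst_add, Prod.snd_add, circ_add, add_pow_char_pow, Prod.mk_add_mk,
    Prod.mk.injEq]
  constructor
  · ring
  · ring

theorem add_preMul (k r : ℕ) (α : K) (u v w : K × K) :
    preMul p k r α (u + v) w = preMul p k r α u w + preMul p k r α v w := by
  rw [preMul_comm, preMul_add, preMul_comm _ _ _ w, preMul_comm _ _ _ w]

variable [Fintype K]

theorem eq_zero_of_pow_eq_neg (hp : p ≠ 2) (hK : Fintype.card K = p ^ m) {k : ℕ}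
    (hodd : Odd (m / m.gcd k)) {x : K} (h : x ^ p ^ k = -x) : x = 0 := by
  have hn : ∀ n : ℕ, x ^ (p ^ k) ^ n = (-1) ^ n * x := by
    intro n
    induction n with
    | zero => simp
    | succ n ih =>
      rw [pow_succ (p ^ k), pow_mul, ih, mul_pow, h, ← pow_mul, mul_comm n, pow_mul,
        (odd_of_card hp k).neg_one_pow, pow_succ]
      ring
  have h1 := hn (m / m.gcd k)
  rw [pow_pow_div_gcd hK, hodd.neg_one_pow] at h1
  have h2 : 2 * x = 0 := by linear_combination h1
  exact (mul_eq_zero.1 h2).resolve_left (two_ne_zero_of_char hp)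

theorem circ_eq_zero (hp : p ≠ 2) (hK : Fintype.card K = p ^ m) {k : ℕ}
    (hodd : Odd (m / m.gcd k)) {x y : K} (h : circ p k x y = 0) : x = 0 ∨ y = 0 := by
  by_contra! hcon
  obtain ⟨hx, hy⟩ := hcon
  obtain ⟨z, rfl⟩ : ∃ z, y = x * z := ⟨y / x, by field_simp⟩
  rw [circ_mul] at h
  have h1 := (mul_eq_zero.1 h).resolve_left (pow_ne_zero _ hx)
  have := eq_zero_of_pow_eq_neg hp hK hodd (x := z) (by linear_combination h1)
  exact hy (by rw [this, mul_zero])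

/-- The multiplication has no zero divisors: a zero product of vectors with nonzero coordinates has
the shape `(a, b) * (z a, -z b)`, and exhibits `α` as a product of even powers. -/
theorem preMul_ne_zero (hp : p ≠ 2) (hK : Fintype.card K = p ^ m) {k r : ℕ} {α : K}
    (hα : ¬ IsSquare α) (hodd : Odd (m / m.gcd k)) {u v : K × K} (hu : u ≠ 0) (hv : v ≠ 0) :
    preMul p k r α u v ≠ 0 := by
  obtain ⟨a, b⟩ := u
  obtain ⟨c, d⟩ := v
  intro h
  simp only [preMul, Prod.mk_eq_zero] at h
  obtain ⟨h1, h2⟩ := h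
  have hα0 : α ≠ 0 := by rintro rfl; exact hα IsSquare.zero
  have hpk : p ^ k ≠ 0 := pow_ne_zero _ (Fact.out : p.Prime).ne_zero
  have hpr : p ^ r ≠ 0 := pow_ne_zero _ (Fact.out : p.Prime).ne_zero
  by_cases ha : a = 0
  · subst ha
    have hb : b ≠ 0 := by rintro rfl; exact hu rfl
    have hc : c = 0 := by simpa [hb] using h2
    have hd : d ≠ 0 := by rintro rfl; exact hv (by rw [hc]; rfl)
    have h3 : circ p k b d = 0 := by
      have h0 : circ p k 0 c = 0 := by rw [circ, zero_pow hpk]; ring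
      rw [h0, zero_add] at h1
      exact (pow_eq_zero_iff hpr).1 ((mul_eq_zero.1 h1).resolve_left hα0)
    rcases circ_eq_zero hp hK hodd h3 with h | h
    · exact hb h
    · exact hd h
  by_cases hb : b = 0
  · subst hb
    have hd : d = 0 := by simpa [ha] using h2
    have hc : c ≠ 0 := by rintro rfl; exact hv (by rw [hd]; rfl)
    have h3 : circ p k a c = 0 := by
      have h0 : circ p k 0 d = 0 := by rw [circ, zero_pow hpk]; ring
      rwa [h0, zero_pow hpr, mul_zero, add_zero] at h1
    rcases circ_eq_zero hp hK hodd h3 with h | h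
    · exact ha h
    · exact hc h
  obtain ⟨z, rfl⟩ : ∃ z, c = a * z := ⟨c / a, by field_simp⟩
  have hd : d = b * -z := by
    apply mul_left_cancel₀ ha; linear_combination h2
  subst hd
  have hz : z ≠ 0 := by rintro rfl; exact hv (by simp)
  rw [circ_mul, circ_mul, (odd_of_card hp k).neg_pow] at h1
  set w := z + z ^ p ^ k with hw
  have hw0 : w ≠ 0 := fun h0 =>
    hz (eq_zero_of_pow_eq_neg hp hK hodd (by linear_combination h0 - hw))
  have h4 : b ^ (p ^ k + 1) * (-z + -z ^ p ^ k) = -(b ^ (p ^ k + 1) * w) := by rw [hw]; ring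
  rw [h4, (odd_of_card hp r).neg_pow, mul_pow] at h1
  obtain ⟨s, hs⟩ := (odd_of_card hp k).add_one
  obtain ⟨t, ht⟩ := odd_of_card hp r
  have h5 : w ^ p ^ r = w * (w ^ t * w ^ t) := by rw [ht]; ring
  have h6 : ∀ x : K, x ^ (p ^ k + 1) = x ^ s * x ^ s := fun x => by rw [hs, pow_add]
  rw [h5, h6, h6, mul_pow] at h1
  have h7 : a ^ s * a ^ s = α * (((b ^ s) ^ p ^ r * w ^ t) * ((b ^ s) ^ p ^ r * w ^ t)) := by
    apply mul_right_cancel₀ hw0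
    linear_combination h1
  refine hα ⟨a ^ s / ((b ^ s) ^ p ^ r * w ^ t), ?_⟩
  field_simp
  linear_combination -h7

theorem preMul_isPresemifield (hp : p ≠ 2) (hK : Fintype.card K = p ^ m) {k r : ℕ} {α : K}
    (hα : ¬ IsSquare α) (hodd : Odd (m / m.gcd k)) : IsPresemifield (preMul p k r α) :=
  isPresemifield_of_finite (add_preMul k r α) (preMul_add k r α) fun _ _ =>
    preMul_ne_zero hp hK hα hodd

/-- The map `u ↦ u * (1, 0)` as a linear equivalence, under which `⋆` corresponds to `*`. -/
theorem exists_unitEquiv [Algebra (ZMod p) K] (hp : p ≠ 2) (hK : Fintype.card K = p ^ m)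
    {k r : ℕ} {α : K} (hα : ¬ IsSquare α) (hodd : Odd (m / m.gcd k)) :
    ∃ U : (K × K) ≃ₗ[ZMod p] K × K, (∀ u, U u = preMul p k r α u (1, 0)) ∧
      ∀ u v, semiMul p k r α (U u) (U v) = preMul p k r α u v := by
  let f : K × K →ₗ[ZMod p] K × K := AddMonoidHom.toZModLinearMap p
    (AddMonoidHom.mk' (unitMap p k r α) fun u v => add_preMul k r α u v (1, 0))
  have hf : Function.Injective f := by
    refine (injective_iff_map_eq_zero f).2 fun u hu => ?_
    by_contra hu0
    exact preMul_ne_zero hp hK hα hodd hu0 (by simp) hu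
  refine ⟨LinearEquiv.ofBijective f (Finite.injective_iff_bijective.1 hf), fun u => rfl, ?_⟩
  intro u v
  have hinv : Function.LeftInverse (Function.invFun (unitMap p k r α)) (unitMap p k r α) :=
    Function.leftInverse_invFun hf
  change preMul p k r α (Function.invFun (unitMap p k r α) (unitMap p k r α u))
    (Function.invFun (unitMap p k r α) (unitMap p k r α v)) = _
  rw [hinv, hinv]

theorem isotopic_preMul_semiMul [Algebra (ZMod p) K] (hp : p ≠ 2) (hK : Fintype.card K = p ^ m)
    {k r : ℕ} {α : K} (hα : ¬ IsSquare α) (hodd : Odd (m / m.gcd k)) :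
    Isotopic p (preMul p k r α) (semiMul p k r α) := by
  obtain ⟨U, -, hU⟩ := exists_unitEquiv (r := r) hp hK hα hodd
  exact ⟨U, U, .refl _ _, hU⟩

theorem semiMul_isSemifield [Algebra (ZMod p) K] (hp : p ≠ 2) (hK : Fintype.card K = p ^ m)
    {k r : ℕ} {α : K} (hα : ¬ IsSquare α) (hodd : Odd (m / m.gcd k)) :
    IsSemifield (semiMul p k r α) := by
  refine ⟨(isotopic_preMul_semiMul hp hK hα hodd).isPresemifield
    (preMul_isPresemifield hp hK hα hodd), ?_⟩
  obtain ⟨U, hU1, hU⟩ := exists_unitEquiv (r := r) hp hK hα hodd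
  have h : ∀ x, semiMul p k r α x (U (1, 0)) = x := by
    intro x
    obtain ⟨u, rfl⟩ := U.surjective x
    rw [hU, hU1]
  exact ⟨U (1, 0), fun x => ⟨by rw [semiMul_comm, h], h x⟩⟩

end Construction

/-! ### Counting classes of a relation -/

section Classes

variable {X : Type*} {R : X → X → Prop}

theorem HasExactlyClasses.hasPairwiseInequivalent {s : Set X} {n k : ℕ}
    (h : HasExactlyClasses R s n) (hk : k ≤ n) : HasPairwiseInequivalent R s k := by
  obtain ⟨T, hT, rfl, hR, -⟩ := h
  obtain ⟨T', hT', rfl⟩ := Finset.exists_subset_card_eq hk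
  exact ⟨T', fun x hx => hT (hT' hx), rfl, fun x hx y hy => hR x (hT' hx) y (hT' hy)⟩

theorem hasExactlyClasses_biUnion {ι : Type*} (hrefl : ∀ x, R x x) (I : Finset ι) (s : ι → Set X)
    (n : ι → ℕ) (h : ∀ i ∈ I, HasExactlyClasses R (s i) (n i))
    (hR : ∀ i ∈ I, ∀ j ∈ I, i ≠ j → ∀ x ∈ s i, ∀ y ∈ s j, ¬ R x y) :
    HasExactlyClasses R (⋃ i ∈ I, s i) (∑ i ∈ I, n i) := by
  classical
  have h' : ∀ i, ∃ T : Finset X, i ∈ I → (T : Set X) ⊆ s i ∧ T.card = n i ∧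
      (∀ x ∈ T, ∀ y ∈ T, x ≠ y → ¬ R x y) ∧ ∀ x ∈ s i, ∃ y ∈ T, R x y := fun i => by
    by_cases hi : i ∈ I
    · obtain ⟨T, hT⟩ := h i hi
      exact ⟨T, fun _ => hT⟩
    · exact ⟨∅, fun hi' => absurd hi' hi⟩
  choose T hT using h'
  refine ⟨I.biUnion T, ?_, ?_, ?_, ?_⟩
  · intro x hx
    obtain ⟨i, hi, hxi⟩ := Finset.mem_biUnion.1 hx
    exact Set.mem_biUnion hi ((hT i hi).1 hxi)
  · rw [Finset.card_biUnion]
    · exact Finset.sum_congr rfl fun i hi => (hT i hi).2.1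
    · intro i hi j hj hij
      rw [Function.onFun, Finset.disjoint_left]
      exact fun x hx hx' =>
        hR i hi j hj hij x ((hT i hi).1 hx) x ((hT j hj).1 hx') (hrefl x)
  · intro x hx y hy hxy
    obtain ⟨i, hi, hxi⟩ := Finset.mem_biUnion.1 hx
    obtain ⟨j, hj, hyj⟩ := Finset.mem_biUnion.1 hy
    by_cases hij : i = j
    · subst hij
      exact (hT i hi).2.2.1 x hxi y hyj hxy
    · exact hR i hi j hj hij x ((hT i hi).1 hxi) y ((hT j hj).1 hyj)
  · intro x hx
    obtain ⟨i, hi, hxi⟩ := Set.mem_iUnion₂.1 hx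
    obtain ⟨y, hy, hxy⟩ := (hT i hi).2.2.2 x hxi
    exact ⟨y, Finset.mem_biUnion.2 ⟨i, hi, hy⟩, hxy⟩

end Classes

/-! ### Self-adjoint maps and the planar functions of a presemifield -/

section SelfAdjoint

variable {V : Type*} [AddCommGroup V] {p : ℕ} [Module (ZMod p) V]

theorem LinEquivalent.refl (f : V → V) : LinEquivalent p f f :=
  ⟨.refl _ _, .refl _ _, fun _ => rfl⟩

theorem LinEquivalent.symm {f g : V → V} (h : LinEquivalent p f g) : LinEquivalent p g f := by
  obtain ⟨l₁, l₂, h⟩ := h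
  exact ⟨l₁.symm, l₂.symm, fun x => by simp [h]⟩

theorem LinEquivalent.trans {f g h : V → V} (h₁ : LinEquivalent p f g)
    (h₂ : LinEquivalent p g h) : LinEquivalent p f h := by
  obtain ⟨l₁, l₂, h₁⟩ := h₁
  obtain ⟨l₃, l₄, h₂⟩ := h₂
  exact ⟨l₁.trans l₃, l₄.trans l₂, fun x => by simp [h₂, h₁]⟩

/-- Polarization: an equivalence of the functions `x ↦ x * x` and `x ↦ x ∘ x` of two commutative
multiplications is a strong isotopism. -/
theorem LinEquivalent.polarize {mul₁ mul₂ : V → V → V} (h2 : ∀ x : V, x + x = 0 → x = 0)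
    (h₁ : IsPresemifield mul₁) (hc₁ : IsCommMul mul₁) (h₂ : IsPresemifield mul₂)
    (hc₂ : IsCommMul mul₂) (h : LinEquivalent p (fun x => mul₁ x x) (fun x => mul₂ x x)) :
    ∃ l₁ l₂ : V ≃ₗ[ZMod p] V, ∀ x y, mul₂ x y = l₁ (mul₁ (l₂ x) (l₂ y)) := by
  obtain ⟨l₁, l₂, h⟩ := h
  refine ⟨l₁, l₂, fun x y => ?_⟩
  have hxy := h (x + y)
  simp only [map_add, h₁.add_mul, h₁.mul_add, h₂.add_mul, h₂.mul_add, hc₁ (l₂ y) (l₂ x), hc₂ y x,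
    ← h x, ← h y] at hxy
  rw [← sub_eq_zero]
  apply h2
  have h3 : ∀ a b c d : V, a + b + (b + d) = a + c + (c + d) → b - c + (b - c) = 0 := by
    intro a b c d h
    rw [← sub_eq_zero] at h
    rw [← h]; abel
  exact h3 _ _ _ _ hxy

variable (p) in
/-- The self-adjoint maps of a multiplication. For a commutative semifield these are the
multiplications by the elements of the middle nucleus. -/
def selfAdjointMaps (mul : V → V → V) : Set (Module.End (ZMod p) V) :=
  {T | ∀ u v, mul (T u) v = mul u (T v)}

variable {mul : V → V → V}

theorem IsPresemifield.right_cancel (h : IsPresemifield mul) {e x y : V} (he : e ≠ 0)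
    (hxy : mul x e = mul y e) : x = y := by
  rw [← sub_eq_zero]
  by_contra hne
  refine h.mul_ne_zero _ _ hne he ?_
  have : mul (x - y) e = mul x e - mul y e := by
    rw [eq_sub_iff_add_eq, ← h.add_mul, sub_add_cancel]
  rw [this, hxy, sub_self]

/-- Both `S (T u) * u` and `T (S u) * u` equal `S u * T u`. -/
theorem selfAdjoint_commute (h : IsPresemifield mul) (hc : IsCommMul mul)
    {S T : Module.End (ZMod p) V} (hS : S ∈ selfAdjointMaps p mul)
    (hT : T ∈ selfAdjointMaps p mul) : S * T = T * S := by
  ext u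
  by_cases hu : u = 0
  · simp [hu]
  refine h.right_cancel hu ?_
  change mul (S (T u)) u = mul (T (S u)) u
  rw [hS, hT, hc]

theorem selfAdjoint_injective (h : IsPresemifield mul) {T : Module.End (ZMod p) V}
    (hT : T ∈ selfAdjointMaps p mul) (hT0 : T ≠ 0) : Function.Injective T := by
  refine (injective_iff_map_eq_zero T).2 fun u hu => ?_
  by_contra hu0
  refine hT0 (LinearMap.ext fun v => ?_)
  by_contra hv
  refine h.mul_ne_zero _ _ hu0 hv ?_
  rw [← hT, hu, h.zero_mul]

theorem neg_mul_of_presemifield (h : IsPresemifield mul) (u v : V) : mul (-u) v = -mul u v := by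
  rw [eq_neg_iff_add_eq_zero, ← h.add_mul, neg_add_cancel, h.zero_mul]

theorem mul_neg_of_presemifield (h : IsPresemifield mul) (u v : V) : mul u (-v) = -mul u v := by
  rw [eq_neg_iff_add_eq_zero, ← h.mul_add, neg_add_cancel, h.mul_zero]

variable (p) in
/-- The ring of self-adjoint maps of a commutative presemifield. -/
def selfAdjointRing (h : IsPresemifield mul) (hc : IsCommMul mul) :
    Subring (Module.End (ZMod p) V) where
  carrier := selfAdjointMaps p mul
  zero_mem' u v := by simp [h.zero_mul, h.mul_zero]
  one_mem' u v := rfl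
  add_mem' {S T} hS hT u v := by
    simp only [LinearMap.add_apply, h.add_mul, h.mul_add]
    rw [hS, hT]
  neg_mem' {S} hS u v := by
    simp only [LinearMap.neg_apply, neg_mul_of_presemifield h, mul_neg_of_presemifield h]
    rw [hS]
  mul_mem' {S T} hS hT u v := by
    change mul (S (T u)) v = mul u ((S * T) v)
    rw [hS, hT, selfAdjoint_commute h hc hS hT]
    rfl

/-- In a finite field of odd characteristic there are two square classes. -/
theorem exists_sq_or_mul_sq {F : Type*} [Ring F] [IsDomain F] [Finite F] (h2 : (2 : F) ≠ 0)
    {a b : F} (ha : ¬ IsSquare a) (hb : b ≠ 0) : ∃ s, s ≠ 0 ∧ (b = s * s ∨ b = a * (s * s)) := by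
  classical
  have := Fintype.ofFinite F
  -- Wedderburn's little theorem
  let : Field F := (Finite.isDomain_to_isField F).toField
  have hchar : ringChar F ≠ 2 := fun h => h2 (by
    have := ringChar.Nat.cast_ringChar (R := F)
    rw [h] at this
    exact_mod_cast this)
  by_cases hsq : IsSquare b
  · obtain ⟨s, rfl⟩ := hsq
    exact ⟨s, by rintro rfl; simp at hb, .inl rfl⟩
  have ha0 : a ≠ 0 := by rintro rfl; exact ha IsSquare.zero
  have hab : IsSquare (a * b) := by
    rw [← quadraticChar_one_iff_isSquare (mul_ne_zero ha0 hb), map_mul,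
      quadraticChar_neg_one_iff_not_isSquare.2 ha, quadraticChar_neg_one_iff_not_isSquare.2 hsq]
    norm_num
  obtain ⟨s, hs⟩ := hab
  refine ⟨s / a, ?_, .inr ?_⟩
  · refine div_ne_zero ?_ ha0
    rintro rfl
    exact mul_ne_zero ha0 hb (by rw [hs, mul_zero])
  · field_simp
    linear_combination hs

/-- The nonzero self-adjoint maps fall into two square classes, since they form the multiplicative
group of a finite field. -/
theorem selfAdjoint_sq_or [Finite V] (h2 : ∀ x : V, x + x = 0 → x = 0) (h : IsPresemifield mul)
    (hc : IsCommMul mul) {T₁ T : Module.End (ZMod p) V}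
    (hT₁ : T₁ ∈ selfAdjointMaps p mul) (hsq : ∀ S ∈ selfAdjointMaps p mul, T₁ ≠ S * S)
    (hT : T ∈ selfAdjointMaps p mul) (hT0 : T ≠ 0) :
    ∃ S ∈ selfAdjointMaps p mul, S ≠ 0 ∧ (T = S * S ∨ T = T₁ * (S * S)) := by
  let F := selfAdjointRing p h hc
  obtain ⟨u, hu⟩ : ∃ u, T u ≠ 0 := by
    by_contra! hcon
    exact hT0 (LinearMap.ext hcon)
  have h2F : (2 : F) ≠ 0 := by
    intro h0
    apply hu
    apply h2
    rw [← one_add_one_eq_two] at h0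
    simpa using congrArg (fun S : F => (S : Module.End (ZMod p) V) (T u)) h0
  have : Nontrivial F := ⟨2, 0, h2F⟩
  have : NoZeroDivisors F := ⟨fun {S S'} hSS => by
    by_contra! hcon
    have hS := selfAdjoint_injective h S.2 (fun h0 => hcon.1 (Subtype.ext h0))
    have hS' := selfAdjoint_injective h S'.2 (fun h0 => hcon.2 (Subtype.ext h0))
    refine hu (hS' (hS ?_))
    have h3 := congrArg (fun S : F => (S : Module.End (ZMod p) V) (T u)) hSS
    simpa using h3⟩
  have : IsDomain F := NoZeroDivisors.to_isDomain F
  have : Finite (Module.End (ZMod p) V) := Finite.of_injective (fun S => (S : V → V))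
    DFunLike.coe_injective
  obtain ⟨S, hS0, hS⟩ := exists_sq_or_mul_sq (F := F) h2F (a := ⟨T₁, hT₁⟩) (b := ⟨T, hT⟩)
    (by rintro ⟨S, hS⟩; exact hsq S S.2 (congrArg Subtype.val hS))
    (fun h0 => hT0 (congrArg Subtype.val h0))
  exact ⟨S, S.2, fun h0 => hS0 (Subtype.ext h0),
    hS.imp (congrArg Subtype.val) (congrArg Subtype.val)⟩

/-- Replacing a self-adjoint map `T` by `T * S ^ 2` does not change the class of `u ↦ T u * u`. -/
theorem linEquivalent_mul_sq [Finite V] (h : IsPresemifield mul) (hc : IsCommMul mul)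
    {S T : Module.End (ZMod p) V} (hT : T ∈ selfAdjointMaps p mul)
    (hS : S ∈ selfAdjointMaps p mul) (hS0 : S ≠ 0) :
    LinEquivalent p (fun u => mul (T u) u) (fun u => mul ((T * (S * S)) u) u) := by
  refine ⟨.refl _ _, LinearEquiv.ofBijective S
    (Finite.injective_iff_bijective.1 (selfAdjoint_injective h hS hS0)), fun u => ?_⟩
  have hTS : T (S (S u)) = S (T (S u)) :=
    LinearMap.congr_fun (selfAdjoint_commute h hc hT hS) (S u)
  change mul (T (S (S u))) u = mul (T (S u)) (S u)
  rw [hTS, hS]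

/-- The planar functions defined by a commutative presemifield are, up to equivalence, the functions
`u ↦ T u * u` for the nonzero self-adjoint maps `T`. -/
theorem exists_selfAdjoint_of_mem [Nontrivial V] (hc : IsCommMul mul)
    {mul' : V → V → V} (hiso : Isotopic p mul mul') {f : V → V}
    (hf : f ∈ planarFunctionsOf p mul') :
    ∃ T ∈ selfAdjointMaps p mul, T ≠ 0 ∧ LinEquivalent p f (fun u => mul (T u) u) := by
  obtain ⟨op, -, hop, hiso', rfl⟩ := hf
  obtain ⟨M, N, L, hL⟩ := hiso'.trans hiso.symm
  refine ⟨(N.symm.trans M).toLinearMap, fun u v => ?_, fun h0 => ?_, L, N.symm, fun u => ?_⟩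
  · have h1 := hL (N.symm u) (N.symm v)
    have h2 := hL (N.symm v) (N.symm u)
    simp only [LinearEquiv.apply_symm_apply] at h1 h2
    simp only [LinearEquiv.coe_coe, LinearEquiv.trans_apply]
    rw [h1, hc u, h2, hop]
  · obtain ⟨u, hu⟩ := exists_ne (0 : V)
    have := LinearMap.congr_fun h0 u
    simp [hu] at this
  · have h1 := hL (N.symm u) (N.symm u)
    simpa using h1

theorem mem_planarFunctionsOf [Finite V] (h : IsPresemifield mul) (hc : IsCommMul mul)
    {mul' : V → V → V} (hiso : Isotopic p mul mul') {T : Module.End (ZMod p) V}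
    (hT : T ∈ selfAdjointMaps p mul) (hT0 : T ≠ 0) :
    (fun u => mul (T u) u) ∈ planarFunctionsOf p mul' := by
  let e : V ≃ₗ[ZMod p] V := LinearEquiv.ofBijective T
    (Finite.injective_iff_bijective.1 (selfAdjoint_injective h hT hT0))
  have hiso' : Isotopic p (fun u v => mul (T u) v) mul :=
    ⟨e, .refl _ _, .refl _ _, fun _ _ => rfl⟩
  refine ⟨fun u v => mul (T u) v, hiso'.symm.isPresemifield h, fun u v => ?_,
    hiso'.trans hiso, rfl⟩
  change mul (T u) v = mul (T v) u
  rw [hT, hc]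

theorem isotopic_of_linEquivalent {mul' : V → V → V} (h2 : ∀ x : V, x + x = 0 → x = 0)
    {f g : V → V} (hf : f ∈ planarFunctionsOf p mul) (hg : g ∈ planarFunctionsOf p mul')
    (hfg : LinEquivalent p f g) : Isotopic p mul mul' := by
  obtain ⟨op, hop, hopc, hiso, rfl⟩ := hf
  obtain ⟨op', hop', hopc', hiso', rfl⟩ := hg
  obtain ⟨l₁, l₂, hl⟩ := hfg.polarize h2 hop hopc hop' hopc'
  have h1 : Isotopic p op op' := ⟨l₂.symm, l₂.symm, l₁, fun x y => by simp [hl]⟩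
  exact (hiso.symm.trans h1).trans hiso'

end SelfAdjoint

/-! ### Self-adjoint maps of the family -/

section FamilySelfAdjoint

variable {p m : ℕ} {K : Type*} [Field K] [Fact p.Prime]

theorem zero_circ (k : ℕ) (x : K) : circ p k 0 x = 0 := by
  rw [circ, zero_pow (pow_ne_zero _ (Fact.out : p.Prime).ne_zero)]; ring

theorem circ_zero (k : ℕ) (x : K) : circ p k x 0 = 0 := by
  rw [circ, zero_pow (pow_ne_zero _ (Fact.out : p.Prime).ne_zero)]; ring

/-- The second component of the multiplication forces self-adjoint maps to be `K`-linear. -/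
theorem selfAdjoint_form [Algebra (ZMod p) K] {k r : ℕ} {α : K} {T : Module.End (ZMod p) (K × K)}
    (hT : T ∈ selfAdjointMaps p (preMul p k r α)) :
    ∃ A B C : K, ∀ u, T u = (A * u.1 + B * u.2, C * u.1 + A * u.2) := by
  have h : ∀ u v, (T u).1 * v.2 + (T u).2 * v.1 = u.1 * (T v).2 + u.2 * (T v).1 := fun u v =>
    congrArg Prod.snd (hT u v)
  have h1 : ∀ u : K × K, (T u).2 = u.1 * (T (1, 0)).2 + u.2 * (T (1, 0)).1 := fun u => by
    simpa using h u (1, 0)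
  have h2 : ∀ u : K × K, (T u).1 = u.1 * (T (0, 1)).2 + u.2 * (T (0, 1)).1 := fun u => by
    simpa using h u (0, 1)
  have h3 : (T (1, 0)).1 = (T (0, 1)).2 := by simpa using h2 (1, 0)
  refine ⟨(T (1, 0)).1, (T (0, 1)).1, (T (1, 0)).2, fun u => Prod.ext ?_ ?_⟩
  · rw [h2 u, h3]; ring
  · rw [h1 u]; ring

variable [CharP K p] [Fintype K]

theorem exists_pow_ne [NeZero m] (hK : Fintype.card K = p ^ m) {k : ℕ} (hk : (k : ZMod m) ≠ 0) :
    ∃ x : K, x ^ p ^ k ≠ x := by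
  by_contra! hcon
  refine hk (frob_injective hK (MonoidHom.ext fun x => ?_))
  change frob p (k : ZMod m) x = frob p (0 : ZMod m) x
  rw [frob_natCast hK, frob_zero hK, hcon]

/-- For `r ≠ 0` the self-adjoint maps are scalar. -/
theorem selfAdjoint_scalar [Algebra (ZMod p) K] [NeZero m] (hp : p ≠ 2)
    (hK : Fintype.card K = p ^ m) {k r : ℕ} {α : K} (hα : ¬ IsSquare α)
    (hodd : Odd (m / m.gcd k)) (hk : 0 < k) (hr : 0 < r) (hkr : k + r < m)
    {T : Module.End (ZMod p) (K × K)} (hT : T ∈ selfAdjointMaps p (preMul p k r α)) :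
    ∃ A : K, A ^ p ^ k = A ∧ ∀ u, T u = (A * u.1, A * u.2) := by
  have hα0 : α ≠ 0 := by rintro rfl; exact hα IsSquare.zero
  have hpr : p ^ r ≠ 0 := pow_ne_zero _ (Fact.out : p.Prime).ne_zero
  have hpk : p ^ k ≠ 0 := pow_ne_zero _ (Fact.out : p.Prime).ne_zero
  have hk0 := natCast_ne_zero_of_lt (m := m) hk (by omega)
  have hr0 := natCast_ne_zero_of_lt (m := m) hr (by omega)
  have hkr0 := natCast_ne_zero_of_lt (m := m) (n := k + r) (by omega) hkr
  obtain ⟨A, B, C, h⟩ := selfAdjoint_form hT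
  have h1 : ∀ u v, circ p k (T u).1 v.1 + α * circ p k (T u).2 v.2 ^ p ^ r =
      circ p k u.1 (T v).1 + α * circ p k u.2 (T v).2 ^ p ^ r := fun u v =>
    congrArg Prod.fst (hT u v)
  have hA : A ^ p ^ k = A := by
    obtain ⟨x, hx⟩ := exists_pow_ne hK hk0
    have h2 := h1 (x, 0) (1, 0)
    simp only [h, mul_zero, add_zero, mul_one, circ_zero, zero_circ, zero_pow hpr] at h2
    rw [circ, circ, mul_pow, one_pow] at h2
    apply mul_right_cancel₀ (sub_ne_zero.2 hx)
    linear_combination h2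
  have h3 : ∀ x : K, α * circ p k (C * x) 1 ^ p ^ r = circ p k x B := by
    intro x
    have h2 := h1 (x, 0) (0, 1)
    simpa only [h, mul_zero, add_zero, zero_add, mul_one, circ_zero, zero_circ, zero_pow hpr]
      using h2
  have hB : B = 0 := by
    have h4 := eq_zero_of_sum_frob (m := m) (p := p) hK
      (c := fun i => (if i = ((k + r : ℕ) : ZMod m) then α * (C ^ p ^ k) ^ p ^ r else 0) +
        (if i = (r : ZMod m) then α * C ^ p ^ r else 0) - (if i = (k : ZMod m) then B else 0) -
        (if i = 0 then B ^ p ^ k else 0)) (fun x => by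
          simp only [sub_mul, add_mul, ite_mul, zero_mul, Finset.sum_add_distrib,
            Finset.sum_sub_distrib, Finset.sum_ite_eq', Finset.mem_univ, if_true,
            frob_natCast hK, frob_zero hK]
          have h5 := h3 x
          rw [circ, circ, add_pow_char_pow, one_pow, one_mul, mul_one, mul_pow, mul_pow,
            mul_pow] at h5
          rw [pow_add, pow_mul]
          linear_combination h5) 0
    simp only [if_neg hk0.symm, if_neg hr0.symm, if_neg hkr0.symm, if_true, add_zero, zero_sub,
      neg_zero, neg_eq_zero] at h4
    exact (pow_eq_zero_iff hpk).1 h4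
  have hC : C = 0 := by
    have h5 := h3 1
    rw [hB, circ_zero, mul_one] at h5
    have h6 := (pow_eq_zero_iff hpr).1 ((mul_eq_zero.1 h5).resolve_left hα0)
    exact (circ_eq_zero hp hK hodd h6).resolve_right one_ne_zero
  exact ⟨A, hA, fun u => by rw [h, hB, hC]; simp⟩

/-- Multiplication by a nonzero element of `K` as an `𝔽_p`-linear equivalence. -/
noncomputable def scale (p : ℕ) {K : Type*} [Field K] [Algebra (ZMod p) K] (c : K) (hc : c ≠ 0) :
    K ≃ₗ[ZMod p] K :=
  LinearEquiv.ofBijective (LinearMap.mulLeft (ZMod p) c) (mulLeft_bijective₀ c hc)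

/-- A scalar self-adjoint map `A` yields a function equivalent to `u ↦ u * u`: the factor
`A ^ (p ^ r - 1)` by which the two summands of the first component differ is a square. -/
theorem linEquivalent_scalar [Algebra (ZMod p) K] [NeZero m] (hp : p ≠ 2)
    (hK : Fintype.card K = p ^ m) {k r : ℕ} {α A : K} (hA0 : A ≠ 0) (hA : A ^ p ^ k = A) :
    LinEquivalent p (fun u : K × K => preMul p k r α u u)
      (fun u => preMul p k r α (A * u.1, A * u.2) u) := by
  obtain ⟨t, ht⟩ := odd_of_card (p := p) hp r
  obtain ⟨s, hs⟩ := (frob_bijective hK (r : ZMod m)).2 (A ^ t)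
  rw [frob_natCast hK] at hs
  have hs0 : s ≠ 0 := by
    rintro rfl
    rw [zero_pow (pow_ne_zero _ (Fact.out : p.Prime).ne_zero)] at hs
    exact pow_ne_zero t hA0 hs.symm
  have hsq : s ^ p ^ k = s := by
    apply (frob_bijective hK (r : ZMod m)).1
    rw [frob_natCast hK, frob_natCast hK, ← pow_mul, mul_comm, pow_mul, hs, ← pow_mul, mul_comm,
      pow_mul, hA]
  refine ⟨(scale p A hA0).prodCongr (scale p (A / s) (div_ne_zero hA0 hs0)),
    (LinearEquiv.refl _ _).prodCongr (scale p s hs0), fun u => ?_⟩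
  change preMul p k r α (A * u.1, A * u.2) u =
    (A * (preMul p k r α (u.1, s * u.2) (u.1, s * u.2)).1,
      A / s * (preMul p k r α (u.1, s * u.2) (u.1, s * u.2)).2)
  have h1 : ∀ x y, circ p k (A * x) y = A * circ p k x y := fun x y => by
    rw [circ, circ, mul_pow, hA]; ring
  have h2 : ∀ x, circ p k (s * x) (s * x) = s * s * circ p k x x := fun x => by
    rw [circ, circ, mul_pow, hsq]; ring
  simp only [preMul, h1, h2, mul_pow, hs, Prod.mk.injEq]
  constructor
  · rw [ht]; ring
  · field_simp

end FamilySelfAdjoint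

section QuadraticExtension

variable {p m : ℕ} {K : Type*} [Field K] [Fact p.Prime] [Fintype K]

/-- There is a nonsquare fixed by `x ↦ x ^ (p ^ k)`, of the form `α * C ^ (p ^ k + 1)`. -/
theorem exists_fixed_nonsquare (hp : p ≠ 2) (hK : Fintype.card K = p ^ m) {k : ℕ} {α : K}
    (hα : ¬ IsSquare α) (hodd : Odd (m / m.gcd k)) :
    ∃ C : K, ¬ IsSquare (α * C ^ (p ^ k + 1)) ∧
      (α * C ^ (p ^ k + 1)) ^ p ^ k = α * C ^ (p ^ k + 1) := by
  set q := p ^ k with hq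
  set l := m / m.gcd k with hl
  have hα0 : α ≠ 0 := by rintro rfl; exact hα IsSquare.zero
  -- the power `α ^ n` is the norm of `α`
  set n := ∑ i ∈ Finset.range l, q ^ i with hn
  have hnodd : Odd n := by
    rw [hn, Finset.odd_sum_iff_odd_card_odd]
    have h1 : (Finset.range l).filter (fun i => Odd (q ^ i)) = Finset.range l :=
      Finset.filter_true_of_mem fun i _ => (odd_of_card hp k).pow
    rw [h1, Finset.card_range]
    exact hodd
  obtain ⟨t, ht⟩ := hnodd
  -- every square is a `(q + 1)`-th power, as `q + 1` divides `q ^ l + 1`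
  obtain ⟨c, hc⟩ : q + 1 ∣ q ^ l + 1 := by simpa using Odd.nat_add_dvd_pow_add_pow q 1 hodd
  have hC : α * ((α ^ t) ^ c) ^ (q + 1) = α ^ n := by
    rw [← pow_mul, mul_comm c, ← hc, pow_succ (α ^ t), pow_pow_div_gcd hK, ht]; ring
  refine ⟨(α ^ t) ^ c, ?_, ?_⟩
  · rw [hC]
    rintro ⟨s, hs⟩
    refine hα ⟨s / α ^ t, ?_⟩
    have : α ^ n = α ^ t * α ^ t * α := by rw [ht]; ring
    rw [this] at hs
    field_simp
    linear_combination hs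
  · rw [hC]
    apply mul_right_cancel₀ hα0
    have h1 : q * n + 1 = n + q ^ l := by
      have h2 := Finset.sum_range_succ (fun i => q ^ i) l
      rw [Finset.sum_range_succ'] at h2
      rw [hn, Finset.mul_sum]
      simpa [pow_succ'] using h2
    rw [← pow_mul, ← pow_succ, mul_comm, h1, pow_add, pow_pow_div_gcd hK]

variable [CharP K p]

theorem fixed_of_sq_fixed (hp : p ≠ 2) (hK : Fintype.card K = p ^ m) {k : ℕ}
    (hodd : Odd (m / m.gcd k)) {x : K} (h : (x * x) ^ p ^ k = x * x) : x ^ p ^ k = x := by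
  rw [mul_pow] at h
  rcases mul_self_eq_mul_self_iff.1 h with h | h
  · exact h
  · have := eq_zero_of_pow_eq_neg hp hK hodd h
    rw [this, zero_pow (pow_ne_zero _ (Fact.out : p.Prime).ne_zero)]

/-- The norm form `A ^ 2 - β * ρ ^ 2` over the field fixed by `x ↦ x ^ (p ^ k)` takes a nonsquare
value: otherwise `-β` is a square, so that all sums of squares are squares, and `-1` is one of
them. -/
theorem exists_norm_nonsquare (hp : p ≠ 2) (hK : Fintype.card K = p ^ m) {k : ℕ} {β : K}
    (hβ : ¬ IsSquare β) (hβk : β ^ p ^ k = β) (hodd : Odd (m / m.gcd k)) :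
    ∃ A ρ : K, A ^ p ^ k = A ∧ ρ ^ p ^ k = ρ ∧ ¬ IsSquare (A * A - ρ * ρ * β) := by
  by_contra! hcon
  have hβ0 : β ≠ 0 := by rintro rfl; exact hβ IsSquare.zero
  have hpk : p ^ k ≠ 0 := pow_ne_zero _ (Fact.out : p.Prime).ne_zero
  obtain ⟨γ, hγ⟩ := hcon 0 1 (zero_pow hpk) (one_pow _)
  have hγ' : -β = γ * γ := by linear_combination hγ
  have hγk : γ ^ p ^ k = γ := fixed_of_sq_fixed hp hK hodd (by
    rw [← hγ', (odd_of_card hp k).neg_pow, hβk])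
  have hγ0 : γ ≠ 0 := by rintro rfl; apply hβ0; linear_combination -hγ'
  have hsum : ∀ n : ℕ, ∃ δ : K, δ ^ p ^ k = δ ∧ (n : K) = δ * δ := by
    intro n
    induction n with
    | zero => exact ⟨0, zero_pow hpk, by simp⟩
    | succ n ih =>
      obtain ⟨δ, hδ, hn⟩ := ih
      obtain ⟨ε, hε⟩ := hcon δ γ⁻¹ hδ (by rw [inv_pow, hγk])
      have h1 : ((n + 1 : ℕ) : K) = ε * ε := by
        have h2 : γ⁻¹ * γ⁻¹ * β = -1 := by
          rw [neg_eq_iff_eq_neg.1 hγ']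
          field_simp
        rw [← hε, h2, Nat.cast_succ, hn]
        ring
      refine ⟨ε, fixed_of_sq_fixed hp hK hodd ?_, h1⟩
      rw [← h1, ← iterateFrobenius_def, map_natCast]
  obtain ⟨δ, -, hδ⟩ := hsum (p - 1)
  rw [Nat.cast_sub (Fact.out : p.Prime).one_le, CharP.cast_eq_zero] at hδ
  refine hβ ⟨δ * γ, ?_⟩
  push_cast at hδ
  linear_combination (γ * γ) * hδ - hγ'

end QuadraticExtension

/-! ### Classes of planar functions of one semifield -/

section PlanarClasses

variable {p m : ℕ} {K : Type*} [Field K] [CharP K p]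

theorem eq_zero_of_add_self (hp : p ≠ 2) (x : K × K) (hx : x + x = 0) : x = 0 := by
  have h3 := congrArg Prod.fst hx
  have h4 := congrArg Prod.snd hx
  rw [Prod.fst_add, ← two_mul] at h3
  rw [Prod.snd_add, ← two_mul] at h4
  exact Prod.ext ((mul_eq_zero.1 h3).resolve_left (two_ne_zero_of_char hp))
    ((mul_eq_zero.1 h4).resolve_left (two_ne_zero_of_char hp))

variable [Fact p.Prime] [Fintype K] [Algebra (ZMod p) K]

/-- For `r = 0` there is a self-adjoint map whose determinant over `K` is not a square. -/
theorem exists_selfAdjoint_det_nonsquare (hp : p ≠ 2) (hK : Fintype.card K = p ^ m) {k : ℕ}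
    {α : K} (hα : ¬ IsSquare α) (hodd : Odd (m / m.gcd k)) :
    ∃ T ∈ selfAdjointMaps p (preMul p k 0 α), ∃ A B C : K,
      (∀ u, T u = (A * u.1 + B * u.2, C * u.1 + A * u.2)) ∧ ¬ IsSquare (A * A - B * C) := by
  obtain ⟨c, hc, hck⟩ := exists_fixed_nonsquare hp hK hα hodd
  obtain ⟨A, ρ, hA, hρ, hdet⟩ := exists_norm_nonsquare hp hK hc hck hodd
  have hc0 : c ≠ 0 := by
    rintro rfl
    exact hc ⟨0, by simp⟩
  have hcc : (α * c ^ p ^ k) ^ p ^ k = α * c := by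
    apply mul_right_cancel₀ (pow_ne_zero (p ^ k) hc0)
    rw [← mul_pow]
    calc _ = (α * c ^ (p ^ k + 1)) ^ p ^ k := by ring
      _ = _ := by rw [hck]; ring
  refine ⟨(LinearMap.mulLeft (ZMod p) A ∘ₗ LinearMap.fst (ZMod p) K K +
      LinearMap.mulLeft (ZMod p) (ρ * (α * c ^ p ^ k)) ∘ₗ LinearMap.snd (ZMod p) K K).prod
    (LinearMap.mulLeft (ZMod p) (ρ * c) ∘ₗ LinearMap.fst (ZMod p) K K +
      LinearMap.mulLeft (ZMod p) A ∘ₗ LinearMap.snd (ZMod p) K K), ?_,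
    A, ρ * (α * c ^ p ^ k), ρ * c, fun u => rfl, ?_⟩
  · rintro ⟨x, y⟩ ⟨z, w⟩
    have hx : ∀ x y : K, (A * x + ρ * (α * c ^ p ^ k) * y) ^ p ^ k =
        A * x ^ p ^ k + ρ * (α * c) * y ^ p ^ k := fun x y => by
      rw [add_pow_char_pow, mul_pow, mul_pow, mul_pow ρ, hA, hρ, hcc]
    have hy : ∀ x y : K, (ρ * c * x + A * y) ^ p ^ k =
        ρ * c ^ p ^ k * x ^ p ^ k + A * y ^ p ^ k := fun x y => by
      rw [add_pow_char_pow, mul_pow, mul_pow, mul_pow, hA, hρ]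
    change preMul p k 0 α (A * x + ρ * (α * c ^ p ^ k) * y, ρ * c * x + A * y) (z, w) =
      preMul p k 0 α (x, y) (A * z + ρ * (α * c ^ p ^ k) * w, ρ * c * z + A * w)
    simp only [preMul, circ, hx, hy, pow_zero, pow_one, Prod.mk.injEq]
    constructor
    · ring
    · ring
  · convert hdet using 2
    ring

/-- For `r = 0` a self-adjoint map `T` with nonsquare determinant yields a function that is not
equivalent to `u ↦ u * u`. By rigidity, an equivalence given by `N` would transform the second
components by `(N u)₁ (N v)₂ + (N u)₂ (N v)₁ = b ((T u)₁ v₂ + (T u)₂ v₁) ^ (p ^ j)`; comparing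
determinants, the one of `T` would be a square. -/
theorem not_linEquivalent [NeZero m] (hp : p ≠ 2) (hK : Fintype.card K = p ^ m) {k : ℕ}
    {α : K} (hα : ¬ IsSquare α) (hodd : Odd (m / m.gcd k)) (hk : 0 < k) (hkm : 2 * k < m)
    {T : Module.End (ZMod p) (K × K)} (hT : T ∈ selfAdjointMaps p (preMul p k 0 α)) {A B C : K}
    (h : ∀ u, T u = (A * u.1 + B * u.2, C * u.1 + A * u.2)) (hdet : ¬ IsSquare (A * A - B * C)) :
    ¬ LinEquivalent p (fun u => preMul p k 0 α u u) (fun u => preMul p k 0 α (T u) u) := by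
  intro hequiv
  have hpre := preMul_isPresemifield (r := 0) hp hK hα hodd
  have hcomm : IsCommMul (preMul p k 0 α) := preMul_comm k 0 α
  have hT0 : T ≠ 0 := by
    rintro rfl
    have h3 : (0 : K × K) = _ := h (1, 0)
    have hA := congrArg Prod.fst h3
    have hC := congrArg Prod.snd h3
    simp only [Prod.fst_zero, Prod.snd_zero, mul_one, mul_zero, add_zero] at hA hC
    exact hdet ⟨0, by rw [← hA, ← hC]; ring⟩
  let e : (K × K) ≃ₗ[ZMod p] K × K := LinearEquiv.ofBijective T
    (Finite.injective_iff_bijective.1 (selfAdjoint_injective hpre hT hT0))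
  have hiso : Isotopic p (fun u v => preMul p k 0 α (T u) v) (preMul p k 0 α) :=
    ⟨e, .refl _ _, .refl _ _, fun _ _ => rfl⟩
  obtain ⟨l₁, N, hN⟩ := hequiv.polarize (eq_zero_of_add_self hp) hpre hcomm
    (hiso.symm.isPresemifield hpre)
    (fun u v => by rw [hT, preMul_comm])
  have hrig := isotopism_rigid hp hK hα hα hk hkm hk hkm (.inr ⟨rfl, rfl⟩)
    (e.symm.trans N) N l₁.symm (fun u v => by
      have h3 := hN (e.symm u) v
      have h4 : T (e.symm u) = u := e.apply_symm_apply u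
      rw [h4] at h3
      simp [h3])
  obtain ⟨-, j, b, hb, hj⟩ := hrig
  have h3 : ∀ u v, (N u).1 * (N v).2 + (N u).2 * (N v).1 =
      b * frob p j ((T u).1 * v.2 + (T u).2 * v.1) := fun u v => by
    have h5 : (l₁.symm (l₁ (preMul p k 0 α (N u) (N v)))).2 =
        b * frob p j (preMul p k 0 α (T u) v).2 := by rw [← hN, hj]
    rwa [l₁.symm_apply_apply] at h5
  have h11 := h3 (1, 0) (1, 0)
  have h12 := h3 (1, 0) (0, 1)
  have h22 := h3 (0, 1) (0, 1)
  simp only [h, mul_one, mul_zero, add_zero, zero_add] at h11 h12 h22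
  obtain ⟨s, hs⟩ := (frob_bijective hK j).2
    (((N (1, 0)).1 * (N (0, 1)).2 - (N (1, 0)).2 * (N (0, 1)).1) / b)
  refine hdet ⟨s, (frob_bijective hK j).1 ?_⟩
  rw [map_mul, hs, map_sub, map_mul, map_mul]
  field_simp
  linear_combination -(((N (1, 0)).1 * (N (0, 1)).2 + (N (1, 0)).2 * (N (0, 1)).1) +
    b * frob p j A) * h12 + (N (0, 1)).1 * (N (0, 1)).2 * 2 * h11 + b * frob p j C * h22

theorem planarFunctions_classes_zero [NeZero m] (hp : p ≠ 2) (hK : Fintype.card K = p ^ m) {k : ℕ}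
    {α : K} (hα : ¬ IsSquare α) (hodd : Odd (m / m.gcd k)) (hk : 0 < k) (hkm : 2 * k < m) :
    HasExactlyClasses (LinEquivalent p) (planarFunctionsOf p (semiMul p k 0 α)) 2 := by
  classical
  have hpre := preMul_isPresemifield (r := 0) hp hK hα hodd
  have hcomm : IsCommMul (preMul p k 0 α) := preMul_comm k 0 α
  have hiso := isotopic_preMul_semiMul (r := 0) hp hK hα hodd
  obtain ⟨T₁, hT₁, A, B, C, hform, hdet⟩ := exists_selfAdjoint_det_nonsquare hp hK hα hodd
  have hne := not_linEquivalent hp hK hα hodd hk hkm hT₁ hform hdet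
  have hone : (1 : Module.End (ZMod p) (K × K)) ∈ selfAdjointMaps p (preMul p k 0 α) :=
    fun _ _ => rfl
  -- the determinant over `K` is multiplicative on the `K`-linear self-adjoint maps
  have hsq : ∀ S ∈ selfAdjointMaps p (preMul p k 0 α), T₁ ≠ S * S := by
    rintro S hS rfl
    obtain ⟨A', B', C', hS'⟩ := selfAdjoint_form hS
    have h1 := hform (1, 0)
    have h2 := hform (0, 1)
    simp only [Module.End.mul_apply, hS', mul_one, mul_zero, add_zero, zero_add,
      Prod.mk.injEq] at h1 h2
    refine hdet ⟨A' * A' - B' * C', ?_⟩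
    rw [← h1.1, ← h1.2, ← h2.1]
    ring
  have hT₁0 : T₁ ≠ 0 := by
    rintro rfl
    exact hsq 0 (fun u v => by simp [hpre.zero_mul, hpre.mul_zero]) (by simp)
  refine ⟨{fun u => preMul p k 0 α u u, fun u => preMul p k 0 α (T₁ u) u}, ?_, ?_, ?_, ?_⟩
  · intro f hf
    rw [Finset.mem_coe, Finset.mem_insert, Finset.mem_singleton] at hf
    rcases hf with rfl | rfl
    · exact mem_planarFunctionsOf hpre hcomm hiso hone one_ne_zero
    · exact mem_planarFunctionsOf hpre hcomm hiso hT₁ hT₁0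
  · exact Finset.card_pair fun h => hne (h ▸ LinEquivalent.refl _)
  · intro f hf g hg hfg
    rw [Finset.mem_insert, Finset.mem_singleton] at hf hg
    rcases hf with rfl | rfl <;> rcases hg with rfl | rfl
    · exact absurd rfl hfg
    · exact hne
    · exact fun h => hne h.symm
    · exact absurd rfl hfg
  · intro f hf
    obtain ⟨T, hT, hT0, hfT⟩ := exists_selfAdjoint_of_mem hcomm hiso hf
    obtain ⟨S, hS, hS0, rfl | rfl⟩ :=
      selfAdjoint_sq_or (eq_zero_of_add_self hp) hpre hcomm hT₁ hsq hT hT0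
    · refine ⟨_, Finset.mem_insert_self _ _, hfT.trans ?_⟩
      simpa using (linEquivalent_mul_sq hpre hcomm hone hS hS0).symm
    · exact ⟨_, Finset.mem_insert_of_mem (Finset.mem_singleton_self _),
        hfT.trans (linEquivalent_mul_sq hpre hcomm hT₁ hS hS0).symm⟩

theorem planarFunctions_classes_pos [NeZero m] (hp : p ≠ 2) (hK : Fintype.card K = p ^ m)
    {k r : ℕ} {α : K} (hα : ¬ IsSquare α) (hodd : Odd (m / m.gcd k)) (hk : 0 < k) (hr : 0 < r)
    (hkr : k + r < m) :
    HasExactlyClasses (LinEquivalent p) (planarFunctionsOf p (semiMul p k r α)) 1 := by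
  have hpre := preMul_isPresemifield (r := r) hp hK hα hodd
  have hcomm : IsCommMul (preMul p k r α) := preMul_comm k r α
  have hiso := isotopic_preMul_semiMul (r := r) hp hK hα hodd
  refine ⟨{fun u => preMul p k r α u u}, ?_, rfl, ?_, ?_⟩
  · simpa using mem_planarFunctionsOf hpre hcomm hiso (T := 1) (fun _ _ => rfl) one_ne_zero
  · simp +contextual
  · intro f hf
    obtain ⟨T, hT, hT0, hfT⟩ := exists_selfAdjoint_of_mem hcomm hiso hf
    obtain ⟨A, hA, hTA⟩ := selfAdjoint_scalar hp hK hα hodd hk hr hkr hT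
    refine ⟨_, Finset.mem_singleton_self _, hfT.trans ?_⟩
    have hA0 : A ≠ 0 := by
      rintro rfl
      exact hT0 (LinearMap.ext fun u => by simp [hTA])
    have := linEquivalent_scalar (r := r) (α := α) hp hK hA0 hA
    simp only [hTA]
    exact this.symm

end PlanarClasses

/-! ### The parameters of the family -/

section Parameters

theorem two_mul_lt_of_admissible {m k r : ℕ} (h : Admissible m k r) : 2 * k < m := by
  obtain ⟨h0, h1, h2, -⟩ := h
  have h3 : 2 * k ≤ m := by omega
  refine lt_of_le_of_ne h3 ?_
  rintro rfl
  rw [Nat.gcd_mul_left_left, Nat.mul_div_cancel _ h0] at h2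
  exact absurd h2 (by decide)

theorem odd_div_gcd_iff {e μ k : ℕ} (hμ : Odd μ) :
    Odd (2 ^ e * μ / (2 ^ e * μ).gcd k) ↔ 2 ^ e ∣ k := by
  have hμ0 : 0 < μ := hμ.pos
  constructor
  · intro h
    refine dvd_trans ?_ (Nat.gcd_dvd_right (2 ^ e * μ) k)
    have h1 : 2 ^ e ∣ (2 ^ e * μ).gcd k * (2 ^ e * μ / (2 ^ e * μ).gcd k) := by
      rw [Nat.mul_div_cancel' (Nat.gcd_dvd_left _ _)]
      exact dvd_mul_right _ _
    exact (Nat.Coprime.pow_left e (Nat.coprime_two_left.2 h)).dvd_of_dvd_mul_right h1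
  · rintro ⟨j, rfl⟩
    rw [Nat.gcd_mul_left, Nat.mul_div_mul_left _ _ (by positivity)]
    exact hμ.of_dvd_nat (Nat.div_dvd_of_dvd (Nat.gcd_dvd_left _ _))

/-- The first parameters of the family: the multiples of `2 ^ e` up to `m / 2`. -/
def firstParameters (e μ : ℕ) : Finset ℕ := (Finset.Icc 1 (μ / 2)).image (2 ^ e * ·)

theorem card_firstParameters (e μ : ℕ) : (firstParameters e μ).card = μ / 2 := by
  rw [firstParameters, Finset.card_image_of_injective _ (mul_right_injective₀ (by positivity)),
    Nat.card_Icc, Nat.add_sub_cancel]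

theorem mem_firstParameters {e μ k : ℕ} (hμ : Odd μ) :
    k ∈ firstParameters e μ ↔
      0 < k ∧ k ≤ 2 ^ e * μ / 2 ∧ Odd (2 ^ e * μ / (2 ^ e * μ).gcd k) := by
  have h2 : 0 < 2 ^ e := by positivity
  have hle : ∀ j, 2 ^ e * j ≤ 2 ^ e * μ / 2 ↔ j ≤ μ / 2 := fun j => by
    rw [Nat.le_div_iff_mul_le two_pos, Nat.le_div_iff_mul_le two_pos, mul_assoc,
      Nat.mul_le_mul_left_iff h2]
  rw [odd_div_gcd_iff hμ, firstParameters, Finset.mem_image]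
  constructor
  · rintro ⟨j, hj, rfl⟩
    rw [Finset.mem_Icc] at hj
    exact ⟨Nat.mul_pos h2 hj.1, (hle j).2 hj.2, dvd_mul_right _ _⟩
  · rintro ⟨h0, h1, j, rfl⟩
    exact ⟨j, Finset.mem_Icc.2 ⟨Nat.pos_of_mul_pos_left h0, (hle j).1 h1⟩, rfl⟩

variable {p m : ℕ} {K : Type*} [Field K] [Fact p.Prime] [CharP K p] [Fintype K]
  [Algebra (ZMod p) K]

/-- The parameters for which `isotopism_rigid` applies directly; the remaining case `r' = 0 < r` is
obtained by exchanging the two semifields. -/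
theorem parameters_eq_of_isotopic_aux [NeZero m] (hp : p ≠ 2) (hK : Fintype.card K = p ^ m)
    {k r k' r' : ℕ} {α α' : K} (hα : ¬ IsSquare α) (hα' : ¬ IsSquare α')
    (h : Admissible m k r) (h' : Admissible m k' r') (hr : 0 < r' ∨ (r = 0 ∧ r' = 0))
    (hiso : Isotopic p (preMul p k' r' α') (preMul p k r α)) : k = k' ∧ r = r' := by
  have hkm := two_mul_lt_of_admissible h
  have hkm' := two_mul_lt_of_admissible h'
  obtain ⟨hk, -, -, hrm⟩ := h
  obtain ⟨hk', -, -, hrm'⟩ := h'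
  obtain ⟨M, N, L, hL⟩ := hiso
  have hr0 : 0 < r' → (r' : ZMod m) ≠ 0 := fun h0 => natCast_ne_zero_of_lt h0 (by omega)
  obtain ⟨⟨h1, h2⟩, -⟩ := isotopism_rigid hp hK hα hα' hk hkm hk' hkm' (hr.imp_left hr0) M N L hL
  have hcast : ∀ a b : ℕ, a < m → b < m → (a : ZMod m) = b → a = b := fun a b ha hb hab => by
    rw [ZMod.natCast_eq_natCast_iff'] at hab
    rwa [Nat.mod_eq_of_lt ha, Nat.mod_eq_of_lt hb] at hab
  refine ⟨(hcast _ _ (by omega) (by omega) h1).symm, ?_⟩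
  rcases hr with hr | ⟨rfl, rfl⟩
  · rcases h2 with h2 | h2 | h2
    · exact absurd h2 (hr0 hr)
    · exact (hcast _ _ (by omega) (by omega) h2).symm
    · have h3 : ((r' + r : ℕ) : ZMod m) = 0 := by
        push_cast
        linear_combination h2
      have h4 := Nat.le_of_dvd (by omega) ((ZMod.natCast_eq_zero_iff _ _).1 h3)
      omega
  · rfl

/-- Isotopic members of the family have equal parameters. -/
theorem parameters_eq_of_isotopic [NeZero m] (hp : p ≠ 2) (hK : Fintype.card K = p ^ m)
    {k r k' r' : ℕ} {α α' : K} (hα : ¬ IsSquare α) (hα' : ¬ IsSquare α')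
    (h : Admissible m k r) (h' : Admissible m k' r')
    (hiso : Isotopic p (semiMul p k' r' α') (semiMul p k r α)) : k = k' ∧ r = r' := by
  have hiso' : Isotopic p (preMul p k' r' α') (preMul p k r α) :=
    ((isotopic_preMul_semiMul hp hK hα' h'.2.2.1).trans hiso).trans
      (isotopic_preMul_semiMul hp hK hα h.2.2.1).symm
  by_cases hr : 0 < r' ∨ (r = 0 ∧ r' = 0)
  · exact parameters_eq_of_isotopic_aux hp hK hα hα' h h' hr hiso'
  · obtain ⟨h1, h2⟩ := parameters_eq_of_isotopic_aux hp hK hα' hα h' h (by omega) hiso'.symm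
    exact ⟨h1.symm, h2.symm⟩

end Parameters

end SemifieldFamily

theorem mainTheorem8 (p : ℕ) [Fact p.Prime] (hp : p ≠ 2) (e μ m : ℕ) (hμ : Odd μ)
    (hm : m = 2 ^ e * μ) (K : Type*) [Field K] [Fintype K] [Algebra (ZMod p) K]
    (hK : Fintype.card K = p ^ m) (α : ℕ → ℕ → K) (hα : ∀ k r, ¬ IsSquare (α k r)) :
    -- the members of the family are commutative semifields, and they define planar functions
    (∀ mul ∈ SemifieldFamily.semifields p m α,
      SemifieldFamily.IsSemifield mul ∧ SemifieldFamily.IsCommMul mul) ∧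
    (∀ f ∈ SemifieldFamily.planarFunctions p m α, SemifieldFamily.IsPlanar f) ∧
    -- pairwise non-isotopic semifields and pairwise inequivalent planar functions
    SemifieldFamily.HasPairwiseInequivalent (SemifieldFamily.Isotopic p)
      (SemifieldFamily.semifields p m α) (⌊(μ : ℚ) / 2⌋₊ * ⌈(m : ℚ) / 2⌉₊) ∧
    SemifieldFamily.HasPairwiseInequivalent (SemifieldFamily.LinEquivalent p)
      (SemifieldFamily.planarFunctions p m α) (⌊(μ : ℚ) / 2⌋₊ * (⌈(m : ℚ) / 2⌉₊ + 1)) ∧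
    -- the exact numbers of classes (the same numbers as above if `m` is odd)
    SemifieldFamily.HasExactlyClasses (SemifieldFamily.Isotopic p)
      (SemifieldFamily.semifields p m α) (⌊(μ : ℚ) / 2⌋₊ * (⌊(m : ℚ) / 2⌋₊ + 1)) ∧
    SemifieldFamily.HasExactlyClasses (SemifieldFamily.LinEquivalent p)
      (SemifieldFamily.planarFunctions p m α) (⌊(μ : ℚ) / 2⌋₊ * (⌊(m : ℚ) / 2⌋₊ + 2)) := by
  open SemifieldFamily in
  have : CharP K p := charP_of_injective_algebraMap (algebraMap (ZMod p) K).injective p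
  have : NeZero m := ⟨by rw [hm]; exact mul_ne_zero (by positivity) hμ.pos.ne'⟩
  have hfloor : ∀ n : ℕ, ⌊(n : ℚ) / 2⌋₊ = n / 2 := fun n => by
    simpa using Nat.floor_div_eq_div (K := ℚ) n 2
  have hceil : ⌈(m : ℚ) / 2⌉₊ ≤ m / 2 + 1 := by
    rw [Nat.ceil_le, div_le_iff₀ two_pos]
    exact_mod_cast (by omega : m ≤ (m / 2 + 1) * 2)
  let I : Finset (ℕ × ℕ) := firstParameters e μ ×ˢ Finset.range (m / 2 + 1)
  have hI : ∀ i : ℕ × ℕ, i ∈ I ↔ Admissible m i.1 i.2 := fun i => by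
    rw [Finset.mem_product, mem_firstParameters hμ, ← hm, Finset.mem_range, Nat.lt_succ_iff,
      Admissible, and_assoc, and_assoc]
  have hsemi : semifields p m α = ⋃ i ∈ I, {semiMul p i.1 i.2 (α i.1 i.2)} := by
    ext mul
    simp [semifields, hI]
  have hplan : planarFunctions p m α =
      ⋃ i ∈ I, planarFunctionsOf p (semiMul p i.1 i.2 (α i.1 i.2)) := by
    ext f
    rw [planarFunctions, hsemi]
    simp
  have hdist : ∀ i ∈ I, ∀ j ∈ I, i ≠ j →
      ¬ Isotopic p (semiMul p i.1 i.2 (α i.1 i.2)) (semiMul p j.1 j.2 (α j.1 j.2)) := by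
    intro i hi j hj hij hiso
    obtain ⟨h1, h2⟩ := parameters_eq_of_isotopic hp hK (hα j.1 j.2) (hα i.1 i.2) ((hI j).1 hj)
      ((hI i).1 hi) hiso
    exact hij (Prod.ext h1.symm h2.symm)
  have hS : HasExactlyClasses (Isotopic p) (semifields p m α)
      (⌊(μ : ℚ) / 2⌋₊ * (⌊(m : ℚ) / 2⌋₊ + 1)) := by
    have h := hasExactlyClasses_biUnion (Isotopic.refl p) I
      (fun i => {semiMul p i.1 i.2 (α i.1 i.2)}) (fun _ => 1)
      (fun i _ => ⟨{semiMul p i.1 i.2 (α i.1 i.2)}, by simp, rfl, by simp +contextual,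
        fun x hx => ⟨x, by simpa using hx, Isotopic.refl p x⟩⟩)
      (fun i hi j hj hij x hx y hy => by
        rw [Set.mem_singleton_iff] at hx hy
        rw [hx, hy]
        exact hdist i hi j hj hij)
    rwa [← hsemi, Finset.sum_const, smul_eq_mul, mul_one, Finset.card_product,
      card_firstParameters, Finset.card_range, ← hfloor, ← hfloor] at h
  have hP : HasExactlyClasses (LinEquivalent p) (planarFunctions p m α)
      (⌊(μ : ℚ) / 2⌋₊ * (⌊(m : ℚ) / 2⌋₊ + 2)) := by
    have h := hasExactlyClasses_biUnion (LinEquivalent.refl (p := p)) I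
      (fun i => planarFunctionsOf p (semiMul p i.1 i.2 (α i.1 i.2)))
      (fun i => if i.2 = 0 then 2 else 1)
      (fun i hi => by
        have hadm := (hI i).1 hi
        have hkm := two_mul_lt_of_admissible hadm
        obtain ⟨k, r⟩ := i
        obtain ⟨hk, -, hodd, hr⟩ := hadm
        dsimp only at *
        split_ifs with h0
        · subst h0
          exact planarFunctions_classes_zero hp hK (hα k 0) hodd hk hkm
        · exact planarFunctions_classes_pos hp hK (hα k r) hodd hk (by omega) (by omega))
      (fun i hi j hj hij f hf g hg hfg =>
        hdist i hi j hj hij (isotopic_of_linEquivalent (eq_zero_of_add_self hp) hf hg hfg))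
    -- `r = 0` contributes two classes, and each of the other `m / 2` values of `r` contributes one
    have hcount : ∑ i ∈ I, (if i.2 = 0 then 2 else 1) = μ / 2 * (m / 2 + 2) := by
      rw [Finset.sum_product]
      simp [Finset.sum_range_succ', card_firstParameters]
    rwa [← hplan, hcount, ← hfloor, ← hfloor] at h
  refine ⟨fun mul hmul => ?_, fun f hf => ?_, ?_, ?_, hS, hP⟩
  · obtain ⟨k, r, hadm, rfl⟩ := hmul
    exact ⟨semiMul_isSemifield hp hK (hα k r) hadm.2.2.1, semiMul_comm k r _⟩
  · obtain ⟨mul, -, op, hop, hopc, -, rfl⟩ := hf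
    exact hop.isPlanar hopc (eq_zero_of_add_self hp)
  · refine hS.hasPairwiseInequivalent (Nat.mul_le_mul_left _ ?_)
    rwa [hfloor m]
  · refine hP.hasPairwiseInequivalent (Nat.mul_le_mul_left _ ?_)
    rw [hfloor m]
    omega
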